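/- Let $\nu>0$, $\alpha\in\,]0,1[$, $\beta\in\,]2\alpha,\alpha+1]$ and $\gamma\in\,]\max\{\alpha+1-\beta,\alpha/2\},1[$. Then there exists a constant $C_1>0$, depending only on $\alpha,\beta,\gamma,\nu$, with the following property. Let $\epsilon>0$, $m>2$, $\theta_0\in H^m(\mathbb{R}^2)$ be real-valued, and let $\theta\in \mathcal{C}([0,\infty[;H^m(\mathbb{R}^2))\cap \mathcal{C}^\infty(]0,\infty[\times\mathbb{R}^2)$ be a (real-valued) global smooth solution of $$\partial_t\theta+u\cdot\nabla\theta+\nu\Lambda^\beta\theta-\epsilon\Delta\theta=0,\qquad u=\Lambda^\alpha\mathcal{R}^\perp\theta,\qquad \theta(0,x)=\theta_0(x),$$ where $\widehat{\Lambda^s f}(\zeta)=|\zeta|^s\hat f(\zeta)$, $\mathcal{R}^\perp=(-\mathcal{R}_2,\mathcal{R}_1)$ and $\mathcal{R}_j$ are the Riesz transforms, $\widehat{\mathcal{R}_jf}(\zeta)=-i\frac{\zeta_j}{|\zeta|}\hat f(\zeta)$. Let $H,\delta>0$ and $c_1\in\,]0,1/2]$, and set $$\omega(\xi)=\begin{cases}(H/\delta^\gamma)\,\xi^\gamma,&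 \xi\in\,]0,\delta],\\ H,&\xi\in\,]\delta,\infty[.\end{cases}$$ Suppose that $H\ge 2(1+c_1)\|\theta_0\|_{L^\infty}$, that $H\le C_1\delta^{\alpha+1-\beta}$, and that $\theta_0$ obeys $\omega$, that is, $|\theta_0(x)-\theta_0(y)|<\omega(|x-y|)$ for all $x\ne y$ in $\mathbb{R}^2$. Then $\theta(t,\cdot)$ obeys $\omega$ for every $t>0$, that is, $|\theta(t,x)-\theta(t,y)|<\omega(|x-y|)$ for all $x\neq y$ in $\mathbb{R}^2$ and all $t>0$. In particular $C_1$ does not depend on $\epsilon$. -/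

import Mathlib

open MeasureTheory Filter Topology Set
open scoped ENNReal FourierTransform Laplacian

noncomputable section

namespace GQG

/-- The plane `ℝ²` with its Euclidean norm. -/
abbrev Plane : Type := EuclideanSpace ℝ (Fin 2)

/-- Complex-valued `L²(ℝ²)`; its Fourier transform `𝓕` is the Plancherel extension of
`𝓕 f ζ = ∫ exp (-2 π i x·ζ) f x dx`, so that Mathlib's frequency `ζ` corresponds to the
angular frequency `2 π ζ`. -/
abbrev L2 : Type := Lp ℂ 2 (volume : Measure Plane)

/-- `g = σ(D) f` in `L²(ℝ²)`: both `f` and `g` are square integrable, and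
`ĝ(k) = σ(k) f̂(k)` for almost every angular frequency `k = 2 π ζ`. -/
def IsFourierMultiplier (σ : Plane → ℂ) (f g : Plane → ℝ) : Prop :=
  ∃ (hf : MemLp (fun x => (f x : ℂ)) 2 (volume : Measure Plane))
    (hg : MemLp (fun x => (g x : ℂ)) 2 (volume : Measure Plane)),
    ∀ᵐ ζ ∂(volume : Measure Plane),
      (𝓕 (hg.toLp _) : L2) ζ = σ ((2 * Real.pi) • ζ) * (𝓕 (hf.toLp _) : L2) ζ

/-- Symbol `|k| ^ s` of `Λ ^ s = (-Δ) ^ (s / 2)`. -/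
def lambdaSymbol (s : ℝ) (k : Plane) : ℂ := ((‖k‖ ^ s : ℝ) : ℂ)

/-- Symbol `-i k_j / |k|` of the Riesz transform `R_j`. -/
def rieszSymbol (j : Fin 2) (k : Plane) : ℂ := -Complex.I * ((k j / ‖k‖ : ℝ) : ℂ)

/-- `g = Λ ^ s f`. -/
def IsFracLaplacian (s : ℝ) (f g : Plane → ℝ) : Prop :=
  IsFourierMultiplier (lambdaSymbol s) f g

/-- `v = Λ ^ α R^⊥ f`, where `R^⊥ = (-R_2, R_1)` (the coordinates are numbered `0, 1` here). -/
def IsVelocity (α : ℝ) (f : Plane → ℝ) (v : Plane → Plane) : Prop :=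
  IsFourierMultiplier (fun k => lambdaSymbol α k * -rieszSymbol 1 k) f (fun x => v x 0) ∧
  IsFourierMultiplier (fun k => lambdaSymbol α k * rieszSymbol 0 k) f (fun x => v x 1)

/-- The inhomogeneous Sobolev norm
`‖f‖_{H^s} = (∫ (1 + |2 π ζ|²) ^ s |𝓕 f ζ|² dζ) ^ (1/2)`, possibly `∞`, of `f ∈ L²`
(for `s ≥ 0` every element of `H^s` is in `L²`). -/
def sobolevNorm (s : ℝ) (f : L2) : ℝ≥0∞ :=
  eLpNorm (fun ζ : Plane => (1 + ‖(2 * Real.pi) • ζ‖ ^ 2) ^ (s / 2) * ‖(𝓕 f : L2) ζ‖) 2 volume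

/-- `θ ∈ C([0, ∞); H^m(ℝ²))`, for `m ≥ 0`. -/
def ContinuousInSobolev (m : ℝ) (θ : ℝ → Plane → ℝ) : Prop :=
  ∃ Θ : ℝ → L2,
    (∀ t, 0 ≤ t → ∀ᵐ x ∂(volume : Measure Plane), Θ t x = (θ t x : ℂ)) ∧
    (∀ t, 0 ≤ t → sobolevNorm m (Θ t) < ∞) ∧
    ∀ t, 0 ≤ t → Tendsto (fun s => sobolevNorm m (Θ s - Θ t)) (𝓝[Ici 0] t) (𝓝 0)

/-- `θ` is a global smooth solution, in the class
`C([0, ∞); H^m(ℝ²)) ∩ C^∞((0, ∞) × ℝ²)`, of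
`∂ₜ θ + u · ∇θ + ν Λ^β θ - ε Δθ = 0`, `u = Λ^α R^⊥ θ`, `θ(0, ·) = θ₀`.
In particular `θ₀ ∈ H^m(ℝ²)`. The functions `u t` and `Λ^β (θ t)` are determined by `θ t` up to
null sets. Only the values `θ t` with `t ≥ 0` are relevant. -/
structure IsGlobalSmoothSolution (α β ν ε m : ℝ) (θ₀ : Plane → ℝ) (θ : ℝ → Plane → ℝ) :
    Prop where
  initial : θ 0 = θ₀
  sobolev : ContinuousInSobolev m θ
  smooth : ContDiffOn ℝ (⊤ : ℕ∞) (fun p : ℝ × Plane => θ p.1 p.2) (Ioi 0 ×ˢ univ)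
  equation : ∀ t, 0 < t → ∃ (u : Plane → Plane) (g : Plane → ℝ),
    IsVelocity α (θ t) u ∧ IsFracLaplacian β (θ t) g ∧
    ∀ᵐ x ∂(volume : Measure Plane),
      deriv (fun s => θ s x) t + fderiv ℝ (θ t) x (u x) + ν * g x - ε * Δ (θ t) x = 0

/-- `f` obeys the modulus of continuity `w`. -/
def Obeys (f : Plane → ℝ) (w : ℝ → ℝ) : Prop :=
  ∀ x y : Plane, x ≠ y → |f x - f y| < w ‖x - y‖

/-- The stationary modulus `ω(ξ) = (H / δ^γ) ξ^γ` for `0 < ξ ≤ δ` and `ω(ξ) = H` for `ξ > δ`. -/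
def stationaryModulus (H δ γ : ℝ) (ξ : ℝ) : ℝ :=
  if ξ ≤ δ then H / δ ^ γ * ξ ^ γ else H

end GQG

end

/-!
Preservation of a stationary modulus of continuity by the dissipative generalized surface
quasi-geostrophic equation.

Write `A = H / δ ^ γ`. Since the sup norm of the solution does not grow
(`abs_le_of_drift_diffusion`), increments stay below `H / (1 + c₁) < H`, and only the power modulus
`A ξ ^ γ` at scales `ξ < δ` has to be preserved. If it is ever violated, there is a first time at
which it is touched by a pair `x ≠ y` (`sub_lt_of_forall_not_touching`): the solution vanishes at
infinity and is Lipschitz, locally uniformly in time, because `H^m` with `m > 2` embeds into the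
functions with `∫ (1 + |ζ|) |𝓕 f| < ∞` (`exists_eLpNorm_fourier_le_sobolevNorm`). At that time the
increment `θ(t, x) - θ(t, y)` is nondecreasing in `t`, and this is contradicted as follows.

Let `ξ = |x - y|`. Let `W(z) = A ξ ^ γ - (θ(x + z) - θ(y + z)) ≥ 0` be the defect of the translated
pair, and `S(z) = W(z) + W(-z)` its even part. The function `W` is minimal at `z = 0`, so the
gradients of `θ` at `x` and `y` agree, and the term with `ε` has a favourable sign whatever `ε` is.

* The increment of `Λ ^ β θ` is a positive multiple of the dissipation
  `D = ∫ S(z) |z| ^ (-2 - β) dz`. Since two consecutive increments telescope and the modulus is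
  strictly concave, `W(z) + W(z + x - y) ≥ (2 - 2 ^ γ) A ξ ^ γ`, whence `D ≥ c A ξ ^ (γ - β)`
  (`IsTouching.le_dissipation`).
* The velocity is a singular integral with the odd kernel `z^⊥ |z| ^ (-3 - α)`, so the increment of
  a component of it only involves `W(-z) - W(z)`, which is at most `S(z)` in absolute value. The
  part of the kernel singular at scales below `ξ` therefore contributes at most `ξ ^ (β - α) D`
  (`IsTouching.near_le`). The rest of the kernel is Lipschitz; moving the translation by `x - y`
  onto it gives `C A ξ ^ (γ - α) ≤ C' ξ ^ (β - α) D` (`IsTouching.abs_integral_flattened_le`).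

Hence advection is at most `C'' (A ξ ^ (γ - 1)) ξ ^ (β - α) D`, and
`A ξ ^ (γ - 1 + β - α) ≤ H δ ^ (β - α - 1) ≤ C₁` because `γ > α + 1 - β` and `ξ ≤ δ`; for small `C₁`
the dissipation wins (`IsGlobalSmoothSolution.not_touching`).

The equation is only assumed almost everywhere, with `L²` representatives. It holds everywhere with
singular integrals in place of the multipliers (`IsGlobalSmoothSolution.equation_everywhere`). For
the velocity this follows from absolutely convergent Fourier inversion
(`oddIntegral_eq_fourierInv`); for `Λ ^ β`, which need not have an integrable Fourier transform, it
is proved by duality with test functions (`IsFracLaplacian.ae_eq_evenIntegral`).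
-/

namespace GQG

/-! ### Fourier inversion on the plane -/

/-- The multiplication formula for the Plancherel extension of the Fourier transform. -/
theorem integral_schwartz_mul_eq (φ : SchwartzMap Plane ℂ) (f : L2) :
    ∫ x, φ x * f x = ∫ ζ, 𝓕⁻ (φ : Plane → ℂ) ζ * (𝓕 f : L2) ζ := by
  have h := congrArg (fun T : TemperedDistribution Plane ℂ => T (𝓕⁻ φ))
    (Lp.fourier_toTemperedDistribution_eq f)
  simp only [TemperedDistribution.fourier_apply, Lp.toTemperedDistribution_apply, smul_eq_mul,
    FourierTransform.fourier_fourierInv_eq, SchwartzMap.fourierInv_coe] at h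
  exact h

theorem integral_mul_fourierInv_eq {φ G : Plane → ℂ} (hφ : Integrable φ) (hG : Integrable G) :
    ∫ x, φ x * 𝓕⁻ G x = ∫ ζ, 𝓕⁻ φ ζ * G ζ := by
  have h := VectorFourier.integral_fourierIntegral_smul_eq_flip (μ := volume) (ν := volume)
    (L := -(innerₗ Plane)) (e := Real.fourierChar) Real.continuous_fourierChar (by
      simpa using! (continuous_fst.inner continuous_snd).neg) hφ hG
  have e1 : ∀ (F : Plane → ℂ) (w : Plane), VectorFourier.fourierIntegral Real.fourierChar volume
      (-(innerₗ Plane)) F w = 𝓕⁻ F w := by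
    intro F w
    simp [VectorFourier.fourierIntegral, Real.fourierInv_eq]
  have e2 : ∀ (F : Plane → ℂ) (w : Plane), VectorFourier.fourierIntegral Real.fourierChar volume
      (-(innerₗ Plane)).flip F w = 𝓕⁻ F w := by
    intro F w
    simp [VectorFourier.fourierIntegral, Real.fourierInv_eq, real_inner_comm]
  simp only [e1, e2, smul_eq_mul] at h
  exact h.symm

theorem continuous_fourierInv {G : Plane → ℂ} (hG : Integrable G) : Continuous (𝓕⁻ G) := by
  have h : 𝓕⁻ G = fun x => 𝓕 G (-x) := funext fun x => Real.fourierInv_eq_fourier_neg G x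
  rw [h]
  exact (VectorFourier.fourierIntegral_continuous Real.continuous_fourierChar
    (by exact continuous_inner) hG).comp continuous_neg

theorem tendsto_fourierInv_cocompact (G : Plane → ℂ) :
    Tendsto (𝓕⁻ G) (cocompact Plane) (𝓝 0) := by
  have h : 𝓕⁻ G = fun x => 𝓕 G (-x) := funext fun x => Real.fourierInv_eq_fourier_neg G x
  rw [h]
  have h1 : Tendsto (𝓕 G) (cocompact Plane) (𝓝 0) := by
    simpa only [Real.fourier_eq] using! tendsto_integral_exp_inner_smul_cocompact G
  exact h1.comp (Homeomorph.neg Plane).isClosedEmbedding.tendsto_cocompact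

theorem integrable_fourierInv_integrand {G : Plane → ℂ} (hG : Integrable G) (x : Plane) :
    Integrable fun ζ : Plane => Real.fourierChar (inner ℝ ζ x) • G ζ := by
  have := (Real.fourierIntegral_convergent_iff (f := G) (μ := volume) (-x)).2 hG
  simpa using this

theorem norm_fourierInv_le (G : Plane → ℂ) (x : Plane) : ‖𝓕⁻ G x‖ ≤ ∫ ζ, ‖G ζ‖ := by
  rw [Real.fourierInv_eq]
  refine (norm_integral_le_integral_norm _).trans (le_of_eq ?_)
  simp [Circle.norm_smul]

theorem fourierInv_sub {G₁ G₂ : Plane → ℂ} (h₁ : Integrable G₁) (h₂ : Integrable G₂) (x : Plane) :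
    𝓕⁻ (fun ζ => G₁ ζ - G₂ ζ) x = 𝓕⁻ G₁ x - 𝓕⁻ G₂ x := by
  simp only [Real.fourierInv_eq]
  rw [← integral_sub (integrable_fourierInv_integrand h₁ x) (integrable_fourierInv_integrand h₂ x)]
  simp [smul_sub]

theorem norm_fourierChar_sub_le (a b : ℝ) :
    ‖(Real.fourierChar a : ℂ) - Real.fourierChar b‖ ≤ 2 * Real.pi * |a - b| := by
  have h : (Real.fourierChar a : ℂ) - Real.fourierChar b
      = Real.fourierChar b * ((Real.fourierChar (a - b) : ℂ) - 1) := by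
    rw [mul_sub, mul_one, ← Circle.coe_mul, ← AddChar.map_add_eq_mul]
    simp
  rw [h, norm_mul, Circle.norm_coe, one_mul, Real.fourierChar_apply]
  have := Real.norm_exp_I_mul_ofReal_sub_one_le (x := 2 * Real.pi * (a - b))
  rw [mul_comm] at this
  refine this.trans (le_of_eq ?_)
  rw [Real.norm_eq_abs, abs_mul, abs_of_pos Real.two_pi_pos]

theorem norm_fourierInv_sub_le {G : Plane → ℂ} (hG : Integrable G)
    (hG' : Integrable fun ζ => ‖ζ‖ * ‖G ζ‖) (x y : Plane) :
    ‖𝓕⁻ G x - 𝓕⁻ G y‖ ≤ 2 * Real.pi * (∫ ζ, ‖ζ‖ * ‖G ζ‖) * ‖x - y‖ := by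
  simp only [Real.fourierInv_eq]
  rw [← integral_sub (integrable_fourierInv_integrand hG x) (integrable_fourierInv_integrand hG y)]
  refine (norm_integral_le_of_norm_le ((hG'.const_mul (2 * Real.pi)).mul_const ‖x - y‖)
    (Eventually.of_forall fun ζ => ?_)).trans (le_of_eq ?_)
  · simp only [Circle.smul_def]
    rw [← sub_smul, norm_smul]
    calc _ ≤ (2 * Real.pi * |inner ℝ ζ x - inner ℝ ζ y|) * ‖G ζ‖ := by
          gcongr; exact norm_fourierChar_sub_le _ _
      _ ≤ (2 * Real.pi * (‖ζ‖ * ‖x - y‖)) * ‖G ζ‖ := by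
          gcongr
          rw [← inner_sub_right]; exact abs_real_inner_le_norm _ _
      _ = _ := by ring
  · rw [integral_mul_const, integral_const_mul]

/-- Fourier inversion in `L²` for functions with integrable Fourier transform. -/
theorem ae_eq_fourierInv {f : L2} {G : Plane → ℂ} (hfG : (𝓕 f : L2) =ᵐ[volume] G)
    (hG : Integrable G) : f =ᵐ[volume] 𝓕⁻ G := by
  refine ae_eq_of_integral_contDiff_smul_eq ((Lp.memLp f).locallyIntegrable (by norm_num))
    (continuous_fourierInv hG).locallyIntegrable fun φ hφ hc => ?_
  have hc' : HasCompactSupport fun x => (φ x : ℂ) := hc.comp_left (g := ((↑) : ℝ → ℂ)) rfl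
  have hφ' : ContDiff ℝ (⊤ : ℕ∞) fun x => (φ x : ℂ) := Complex.ofRealCLM.contDiff.comp hφ
  have h1 := integral_schwartz_mul_eq (hc'.toSchwartzMap hφ') f
  have h2 := integral_mul_fourierInv_eq (hφ'.continuous.integrable_of_hasCompactSupport hc') hG
  simp only [Complex.real_smul]
  rw [h2]
  refine Eq.trans h1 (integral_congr_ae ?_)
  filter_upwards [hfG] with ζ hζ
  rw [hζ]; rfl

/-! ### The Sobolev embedding and curves in `H^m` -/

theorem memLp_sobolev_weight {m : ℝ} (hm : 2 < m) :
    MemLp (fun ζ : Plane => (1 + ‖ζ‖) * (1 + ‖(2 * Real.pi) • ζ‖ ^ 2) ^ (-(m / 2))) 2 volume := by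
  have hc : Continuous fun ζ : Plane =>
      (1 + ‖ζ‖) * (1 + ‖(2 * Real.pi) • ζ‖ ^ 2) ^ (-(m / 2)) := by
    refine (continuous_const.add continuous_norm).mul ?_
    refine Continuous.rpow_const (by fun_prop) fun ζ => Or.inl (by positivity)
  rw [memLp_two_iff_integrable_sq hc.aestronglyMeasurable]
  have h := (integrable_one_add_norm (E := Plane) (μ := volume) (r := 2 * m - 2)
    (by simp; linarith)).const_mul (2 ^ m)
  refine h.mono' (hc.pow 2).aestronglyMeasurable (Eventually.of_forall fun ζ => ?_)
  have h0 : 0 < 1 + ‖ζ‖ := by positivity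
  have h1 : (1 + ‖ζ‖) ^ 2 / 2 ≤ 1 + ‖(2 * Real.pi) • ζ‖ ^ 2 := by
    rw [norm_smul, mul_pow]
    have : (1 : ℝ) ≤ ‖2 * Real.pi‖ ^ 2 := by
      rw [Real.norm_eq_abs, abs_of_pos Real.two_pi_pos]
      nlinarith [Real.pi_gt_three]
    nlinarith [sq_nonneg (‖ζ‖ - 1), mul_le_mul_of_nonneg_right this (sq_nonneg ‖ζ‖)]
  rw [Real.norm_eq_abs, abs_of_nonneg (by positivity), mul_pow]
  have h2 : ((1 + ‖(2 * Real.pi) • ζ‖ ^ 2) ^ (-(m / 2))) ^ 2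
      ≤ 2 ^ m * (1 + ‖ζ‖) ^ (-(2 * m)) := by
    rw [← Real.rpow_natCast, ← Real.rpow_mul (by positivity)]
    have e : -(m / 2) * ((2 : ℕ) : ℝ) = -m := by push_cast; ring
    rw [e]
    refine (Real.rpow_le_rpow_of_nonpos (by positivity) h1 (by linarith)).trans (le_of_eq ?_)
    rw [Real.div_rpow (by positivity) (by norm_num), ← Real.rpow_natCast,
      ← Real.rpow_mul h0.le, Real.rpow_neg (by norm_num : (0 : ℝ) ≤ 2) m]
    have e' : ((2 : ℕ) : ℝ) * -m = -(2 * m) := by push_cast; ring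
    rw [e', div_inv_eq_mul, mul_comm]
  calc _ ≤ (1 + ‖ζ‖) ^ 2 * (2 ^ m * (1 + ‖ζ‖) ^ (-(2 * m))) := by gcongr
    _ = 2 ^ m * ((1 + ‖ζ‖) ^ (2 : ℝ) * (1 + ‖ζ‖) ^ (-(2 * m))) := by
        rw [Real.rpow_two]; ring
    _ = _ := by rw [← Real.rpow_add h0]; congr 2; ring

/-- The Sobolev embedding in the form used here: for `m > 2` the `H^m` norm controls the weighted
`L¹` norm `∫ (1 + |ζ|) |𝓕 f ζ| dζ`, hence the sup norm and the Lipschitz constant of `f`. -/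
theorem exists_eLpNorm_fourier_le_sobolevNorm {m : ℝ} (hm : 2 < m) :
    ∃ C : ℝ≥0∞, C ≠ ∞ ∧ ∀ f : L2,
      eLpNorm (fun ζ : Plane => (1 + ‖ζ‖) * ‖(𝓕 f : L2) ζ‖) 1 volume ≤ C * sobolevNorm m f := by
  refine ⟨_, (memLp_sobolev_weight hm).eLpNorm_ne_top, fun f => ?_⟩
  have hmeas : AEStronglyMeasurable
      (fun ζ : Plane => (1 + ‖(2 * Real.pi) • ζ‖ ^ 2) ^ (m / 2) * ‖(𝓕 f : L2) ζ‖) volume := by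
    refine AEStronglyMeasurable.mul (Continuous.aestronglyMeasurable ?_)
      (Lp.memLp (𝓕 f : L2)).aestronglyMeasurable.norm
    exact Continuous.rpow_const (by fun_prop) fun ζ => Or.inl (by positivity)
  have := eLpNorm_smul_le_mul_eLpNorm (p := 2) (q := 2) (r := 1) hmeas
    (memLp_sobolev_weight hm).aestronglyMeasurable
  refine le_trans (le_of_eq ?_) this
  congr 1
  funext ζ
  have h0 : 0 < 1 + ‖(2 * Real.pi) • ζ‖ ^ 2 := by positivity
  simp only [Pi.smul_apply', smul_eq_mul]
  rw [Real.rpow_neg h0.le]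
  field_simp

/-- `F t` is the Fourier transform of `θ t` for every `t ≥ 0`, it has a finite weighted norm
`∫ (1 + |ζ|) |F t ζ| dζ`, and it depends continuously on `t` in this norm. Every curve in
`C([0, ∞); H^m)` with `m > 2` that consists of continuous functions has this property. -/
structure IsSpectralFamily (θ : ℝ → Plane → ℝ) (F : ℝ → Plane → ℂ) : Prop where
  integrable : ∀ t, 0 ≤ t → Integrable (F t)
  integrable_norm_mul : ∀ t, 0 ≤ t → Integrable fun ζ => ‖ζ‖ * ‖F t ζ‖
  eq_fourierInv : ∀ t, 0 ≤ t → ∀ x, (θ t x : ℂ) = 𝓕⁻ (F t) x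
  ae_eq_fourier : ∀ t, 0 ≤ t → ∀ hf : MemLp (fun x => (θ t x : ℂ)) 2 (volume : Measure Plane),
    (𝓕 (hf.toLp _) : L2) =ᵐ[volume] F t
  tendsto : ∀ t, 0 ≤ t →
    Tendsto (fun s => ∫ ζ, (1 + ‖ζ‖) * ‖F s ζ - F t ζ‖) (𝓝[Ici 0] t) (𝓝 0)
  integrable_sub : ∀ s t, 0 ≤ s → 0 ≤ t → Integrable fun ζ => (1 + ‖ζ‖) * ‖F s ζ - F t ζ‖

theorem ContinuousInSobolev.exists_isSpectralFamily {m : ℝ} (hm : 2 < m) {θ : ℝ → Plane → ℝ}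
    (h : ContinuousInSobolev m θ) (hc : ∀ t, 0 ≤ t → Continuous (θ t)) :
    ∃ F, IsSpectralFamily θ F := by
  obtain ⟨Θ, hΘ, hfin, hlim⟩ := h
  obtain ⟨C, hC, hemb⟩ := exists_eLpNorm_fourier_le_sobolevNorm hm
  have hmeas : ∀ f : L2, AEStronglyMeasurable
      (fun ζ : Plane => (1 + ‖ζ‖) * ‖(𝓕 f : L2) ζ‖) volume := fun f =>
    AEStronglyMeasurable.mul (by fun_prop) (Lp.memLp (𝓕 f : L2)).aestronglyMeasurable.norm
  have hint : ∀ f : L2, sobolevNorm m f < ∞ →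
      Integrable fun ζ : Plane => (1 + ‖ζ‖) * ‖(𝓕 f : L2) ζ‖ := fun f hf =>
    memLp_one_iff_integrable.1 ⟨hmeas f, (hemb f).trans_lt (ENNReal.mul_lt_top hC.lt_top hf)⟩
  have hW : ∀ t, 0 ≤ t → Integrable fun ζ : Plane => (1 + ‖ζ‖) * ‖(𝓕 (Θ t) : L2) ζ‖ :=
    fun t ht => hint _ (hfin t ht)
  have hF : ∀ t, 0 ≤ t → Integrable (𝓕 (Θ t) : L2) := fun t ht =>
    (hW t ht).mono (Lp.memLp _).aestronglyMeasurable (Eventually.of_forall fun ζ => by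
      rw [norm_mul, norm_norm, Real.norm_of_nonneg (by positivity : 0 ≤ 1 + ‖ζ‖)]
      nlinarith [norm_nonneg ζ, norm_nonneg ((𝓕 (Θ t) : L2) ζ)])
  have hsub : ∀ s t, (fun ζ : Plane => (1 + ‖ζ‖) * ‖(𝓕 (Θ s - Θ t) : L2) ζ‖) =ᵐ[volume]
      fun ζ => (1 + ‖ζ‖) * ‖(𝓕 (Θ s) : L2) ζ - (𝓕 (Θ t) : L2) ζ‖ := by
    intro s t
    have e : (𝓕 (Θ s - Θ t) : L2) = 𝓕 (Θ s) - 𝓕 (Θ t) :=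
      map_sub (Lp.fourierTransformₗᵢ Plane ℂ) _ _
    rw [e]
    filter_upwards [Lp.coeFn_sub (𝓕 (Θ s)) (𝓕 (Θ t))] with ζ hζ
    rw [hζ]; rfl
  have hsubint : ∀ s t, 0 ≤ s → 0 ≤ t →
      Integrable fun ζ : Plane => (1 + ‖ζ‖) * ‖(𝓕 (Θ s) : L2) ζ - (𝓕 (Θ t) : L2) ζ‖ := by
    intro s t hs ht
    refine ((hW s hs).add (hW t ht)).mono' ?_ (Eventually.of_forall fun ζ => ?_)
    · exact AEStronglyMeasurable.mul (by fun_prop)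
        ((Lp.memLp _).aestronglyMeasurable.sub (Lp.memLp _).aestronglyMeasurable).norm
    · rw [Real.norm_of_nonneg (by positivity), Pi.add_apply, ← mul_add]
      gcongr
      exact norm_sub_le _ _
  refine ⟨fun t => (𝓕 (Θ t) : L2), hF, ?_, ?_, ?_, ?_, hsubint⟩
  · intro t ht
    refine (hW t ht).mono' (AEStronglyMeasurable.mul (by fun_prop)
      (Lp.memLp _).aestronglyMeasurable.norm) (Eventually.of_forall fun ζ => ?_)
    rw [Real.norm_of_nonneg (by positivity)]
    gcongr
    linarith
  · intro t ht
    have h1 : (fun x => (θ t x : ℂ)) =ᵐ[volume] 𝓕⁻ ((𝓕 (Θ t) : L2) : Plane → ℂ) :=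
      (EventuallyEq.symm (hΘ t ht)).trans (ae_eq_fourierInv EventuallyEq.rfl (hF t ht))
    exact congrFun (Continuous.ae_eq_iff_eq volume
      (Complex.continuous_ofReal.comp (hc t ht)) (continuous_fourierInv (hF t ht)) |>.1 h1)
  · intro t ht hf
    have : hf.toLp _ = Θ t := by
      apply Lp.ext
      exact hf.coeFn_toLp.trans (EventuallyEq.symm (hΘ t ht))
    rw [this]
  · intro t ht
    have hlim' : Tendsto (fun s => (C * sobolevNorm m (Θ s - Θ t)).toReal) (𝓝[Ici 0] t) (𝓝 0) := by
      have := ENNReal.Tendsto.const_mul (hlim t ht) (Or.inr hC)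
      rw [mul_zero] at this
      exact (ENNReal.tendsto_toReal ENNReal.zero_ne_top).comp this
    have hev : ∀ᶠ s in 𝓝[Ici 0] t, sobolevNorm m (Θ s - Θ t) < ∞ :=
      (hlim t ht).eventually (gt_mem_nhds ENNReal.zero_lt_top)
    refine squeeze_zero' (Eventually.of_forall fun s => integral_nonneg fun ζ => by positivity) ?_
      hlim'
    filter_upwards [hev] with s hs
    rw [← integral_congr_ae (hsub s t)]
    have e : ∫ ζ, (1 + ‖ζ‖) * ‖(𝓕 (Θ s - Θ t) : L2) ζ‖
        = (eLpNorm (fun ζ : Plane => (1 + ‖ζ‖) * ‖(𝓕 (Θ s - Θ t) : L2) ζ‖) 1 volume).toReal := by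
      rw [eLpNorm_one_eq_lintegral_enorm, ← integral_norm_eq_lintegral_enorm (hmeas _)]
      refine integral_congr_ae (Eventually.of_forall fun ζ => ?_)
      simp only
      rw [Real.norm_of_nonneg (by positivity)]
    rw [e]
    exact ENNReal.toReal_mono (ENNReal.mul_lt_top hC.lt_top hs).ne (hemb _)

namespace IsSpectralFamily

variable {θ : ℝ → Plane → ℝ} {F : ℝ → Plane → ℂ}

theorem continuous (h : IsSpectralFamily θ F) {t : ℝ} (ht : 0 ≤ t) : Continuous (θ t) := by
  have : θ t = fun x => (𝓕⁻ (F t) x).re := by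
    funext x
    rw [← h.eq_fourierInv t ht x, Complex.ofReal_re]
  rw [this]
  exact Complex.continuous_re.comp (continuous_fourierInv (h.integrable t ht))

theorem abs_le (h : IsSpectralFamily θ F) {t : ℝ} (ht : 0 ≤ t) (x : Plane) :
    |θ t x| ≤ ∫ ζ, ‖F t ζ‖ := by
  rw [← Real.norm_eq_abs, ← Complex.norm_real, h.eq_fourierInv t ht]
  exact norm_fourierInv_le _ x

theorem abs_sub_le (h : IsSpectralFamily θ F) {s t : ℝ} (hs : 0 ≤ s) (ht : 0 ≤ t) (x : Plane) :
    |θ s x - θ t x| ≤ ∫ ζ, (1 + ‖ζ‖) * ‖F s ζ - F t ζ‖ := by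
  have e : ((θ s x - θ t x : ℝ) : ℂ) = 𝓕⁻ (fun ζ => F s ζ - F t ζ) x := by
    rw [fourierInv_sub (h.integrable s hs) (h.integrable t ht)]
    push_cast
    rw [h.eq_fourierInv s hs, h.eq_fourierInv t ht]
  rw [← Real.norm_eq_abs, ← Complex.norm_real, e]
  refine (norm_fourierInv_le _ x).trans (integral_mono
    ((h.integrable s hs).sub (h.integrable t ht)).norm (h.integrable_sub s t hs ht) fun ζ => ?_)
  simp only
  nlinarith [norm_nonneg ζ, norm_nonneg (F s ζ - F t ζ)]

theorem tendstoUniformly (h : IsSpectralFamily θ F) {t : ℝ} (ht : 0 ≤ t) {η : ℝ} (hη : 0 < η) :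
    ∀ᶠ s in 𝓝[Ici 0] t, ∀ x, |θ s x - θ t x| < η := by
  filter_upwards [(h.tendsto t ht).eventually (gt_mem_nhds hη), self_mem_nhdsWithin] with s hs hs0 x
  exact (h.abs_sub_le hs0 ht x).trans_lt hs

theorem continuousOn (h : IsSpectralFamily θ F) :
    ContinuousOn (fun p : ℝ × Plane => θ p.1 p.2) (Ici 0 ×ˢ univ) := by
  rintro ⟨t, x⟩ ⟨ht, -⟩
  rw [ContinuousWithinAt, Metric.tendsto_nhds]
  intro η hη
  have ht : 0 ≤ t := ht
  have h1 := h.tendstoUniformly ht (half_pos hη)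
  have h2 : ∀ᶠ y in 𝓝 x, |θ t y - θ t x| < η / 2 :=
    (Metric.tendsto_nhds.1 (h.continuous ht).continuousAt) _ (half_pos hη)
  rw [nhdsWithin_prod_eq, nhdsWithin_univ]
  filter_upwards [h1.prod_mk h2] with p hp
  rw [Real.dist_eq]
  have := _root_.abs_sub_le (θ p.1 p.2) (θ t p.2) (θ t x)
  linarith [hp.1 p.2, hp.2]

theorem exists_uniform_decay (h : IsSpectralFamily θ F) (T : ℝ) {η : ℝ} (hη : 0 < η) :
    ∃ R : ℝ, ∀ t ∈ Icc 0 T, ∀ x, R ≤ ‖x‖ → |θ t x| < η := by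
  refine isCompact_Icc.induction_on
    (p := fun S => ∃ R : ℝ, ∀ t ∈ S, ∀ x : Plane, R ≤ ‖x‖ → |θ t x| < η) ?_ ?_ ?_ ?_
  · exact ⟨0, fun t ht => absurd ht (notMem_empty t)⟩
  · rintro S S' hSS' ⟨R, hR⟩
    exact ⟨R, fun t ht => hR t (hSS' ht)⟩
  · rintro S S' ⟨R, hR⟩ ⟨R', hR'⟩
    refine ⟨max R R', fun t ht x hx => ht.elim (fun ht => hR t ht x ?_) (fun ht => hR' t ht x ?_)⟩
    · exact (le_max_left _ _).trans hx
    · exact (le_max_right _ _).trans hx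
  · intro t ht
    have hlim : Tendsto (θ t) (cocompact Plane) (𝓝 0) := by
      have : θ t = fun x => (𝓕⁻ (F t) x).re := by
        funext x
        rw [← h.eq_fourierInv t ht.1 x, Complex.ofReal_re]
      rw [this]
      exact (Complex.continuous_re.tendsto 0).comp (tendsto_fourierInv_cocompact (F t))
    have h1 : ∀ᶠ x in cocompact Plane, |θ t x| < η / 2 := by
      have := (Metric.tendsto_nhds.1 hlim) _ (half_pos hη)
      simpa [Real.dist_eq] using this
    rw [← Metric.cobounded_eq_cocompact, Filter.hasBasis_cobounded_norm.eventually_iff] at h1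
    obtain ⟨R, -, hR⟩ := h1
    refine ⟨{s | ∀ x, |θ s x - θ t x| < η / 2},
      nhdsWithin_mono t Icc_subset_Ici_self (h.tendstoUniformly ht.1 (half_pos hη)), R, ?_⟩
    intro s hs x hx
    have := abs_add_le (θ s x - θ t x) (θ t x)
    rw [sub_add_cancel] at this
    linarith [hs x, hR hx]

theorem exists_uniform_lipschitz (h : IsSpectralFamily θ F) (T : ℝ) :
    ∃ M : ℝ, 0 ≤ M ∧ ∀ t ∈ Icc 0 T, ∀ x y, |θ t x - θ t y| ≤ M * ‖x - y‖ := by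
  refine isCompact_Icc.induction_on (p := fun S => ∃ M : ℝ, 0 ≤ M ∧ ∀ t ∈ S, ∀ x y : Plane,
    |θ t x - θ t y| ≤ M * ‖x - y‖) ?_ ?_ ?_ ?_
  · exact ⟨0, le_rfl, fun t ht => absurd ht (notMem_empty t)⟩
  · rintro S S' hSS' ⟨R, h0, hR⟩
    exact ⟨R, h0, fun t ht => hR t (hSS' ht)⟩
  · rintro S S' ⟨R, h0, hR⟩ ⟨R', h0', hR'⟩
    refine ⟨max R R', h0.trans (le_max_left _ _), fun t ht x y => ht.elim
      (fun ht => (hR t ht x y).trans ?_) (fun ht => (hR' t ht x y).trans ?_)⟩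
    · gcongr; exact le_max_left _ _
    · gcongr; exact le_max_right _ _
  · intro t ht
    set N : ℝ := ∫ ζ, ‖ζ‖ * ‖F t ζ‖
    have hN : 0 ≤ N := integral_nonneg fun ζ => by positivity
    have hev : ∀ᶠ s in 𝓝[Icc 0 T] t, ∫ ζ, (1 + ‖ζ‖) * ‖F s ζ - F t ζ‖ < 1 :=
      ((h.tendsto t ht.1).mono_left (nhdsWithin_mono t Icc_subset_Ici_self)).eventually
        (gt_mem_nhds one_pos)
    refine ⟨_, inter_mem hev self_mem_nhdsWithin, 2 * Real.pi * (N + 1),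
      by positivity, ?_⟩
    intro s hs x y
    have hs0 : 0 ≤ s := hs.2.1
    have e : |θ s x - θ s y| = ‖𝓕⁻ (F s) x - 𝓕⁻ (F s) y‖ := by
      rw [← h.eq_fourierInv s hs0, ← h.eq_fourierInv s hs0, ← Complex.ofReal_sub,
        Complex.norm_real, Real.norm_eq_abs]
    rw [e]
    refine (norm_fourierInv_sub_le (h.integrable s hs0) (h.integrable_norm_mul s hs0) x y).trans ?_
    have : ∫ ζ, ‖ζ‖ * ‖F s ζ‖ ≤ N + 1 := by
      calc ∫ ζ, ‖ζ‖ * ‖F s ζ‖ ≤ ∫ ζ, (‖ζ‖ * ‖F t ζ‖ + (1 + ‖ζ‖) * ‖F s ζ - F t ζ‖) := by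
            refine integral_mono (h.integrable_norm_mul s hs0)
              ((h.integrable_norm_mul t ht.1).add (h.integrable_sub s t hs0 ht.1)) fun ζ => ?_
            have h1 : ‖F s ζ‖ ≤ ‖F t ζ‖ + ‖F s ζ - F t ζ‖ := by
              have := norm_add_le (F t ζ) (F s ζ - F t ζ)
              simpa using this
            have := mul_le_mul_of_nonneg_left h1 (norm_nonneg ζ)
            simp only
            nlinarith [norm_nonneg (F s ζ - F t ζ)]
        _ = N + ∫ ζ, (1 + ‖ζ‖) * ‖F s ζ - F t ζ‖ :=
            integral_add (h.integrable_norm_mul t ht.1) (h.integrable_sub s t hs0 ht.1)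
        _ ≤ N + 1 := by linarith [show ∫ ζ, (1 + ‖ζ‖) * ‖F s ζ - F t ζ‖ < 1 from hs.1]
    gcongr

end IsSpectralFamily

/-! ### Singular kernels and their symbols -/

theorem integrable_min_rpow_mul_rpow {p s : ℝ} (hs : 0 < s) (hsp : s < p) :
    Integrable fun z : Plane => min (‖z‖ ^ p) 1 * ‖z‖ ^ (-2 - s) := by
  rw [integrable_fun_norm_addHaar volume (f := fun y : ℝ => min (y ^ p) 1 * y ^ (-2 - s))]
  have hmeas : AEStronglyMeasurable (fun y : ℝ =>
      y ^ (Module.finrank ℝ Plane - 1) • (min (y ^ p) 1 * y ^ (-2 - s))) volume :=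
    (by fun_prop : Measurable fun y : ℝ =>
      y ^ (Module.finrank ℝ Plane - 1) • (min (y ^ p) 1 * y ^ (-2 - s))).aestronglyMeasurable
  have hd : Module.finrank ℝ Plane - 1 = 1 := by simp
  rw [← Ioc_union_Ioi_eq_Ioi zero_le_one]
  refine IntegrableOn.union ?_ ?_
  · have h1 : IntegrableOn (fun y : ℝ => y ^ (p - 1 - s)) (Ioc 0 1) := by
      have := intervalIntegral.intervalIntegrable_rpow' (a := 0) (b := 1)
        (r := p - 1 - s) (by linarith)
      rwa [intervalIntegrable_iff_integrableOn_Ioc_of_le zero_le_one] at this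
    refine h1.mono' hmeas.restrict ?_
    filter_upwards [ae_restrict_mem measurableSet_Ioc] with y hy
    have hy0 : 0 < y := hy.1
    rw [hd, pow_one, smul_eq_mul, Real.norm_of_nonneg (by positivity)]
    calc y * (min (y ^ p) 1 * y ^ (-2 - s)) ≤ y ^ (1 : ℝ) * (y ^ p * y ^ (-2 - s)) := by
          rw [Real.rpow_one]; gcongr; exact min_le_left _ _
      _ = y ^ (p - 1 - s) := by
          rw [← Real.rpow_add hy0, ← Real.rpow_add hy0]; congr 1; ring
  · have h1 := integrableOn_Ioi_rpow_of_lt (a := -1 - s) (c := 1) (by linarith) one_pos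
    refine h1.mono' hmeas.restrict ?_
    filter_upwards [ae_restrict_mem measurableSet_Ioi] with y hy
    have hy0 : 0 < y := lt_trans one_pos hy
    rw [hd, pow_one, smul_eq_mul, Real.norm_of_nonneg (by positivity)]
    calc y * (min (y ^ p) 1 * y ^ (-2 - s)) ≤ y ^ (1 : ℝ) * (1 * y ^ (-2 - s)) := by
          rw [Real.rpow_one]; gcongr; exact min_le_right _ _
      _ = y ^ (-1 - s) := by
          rw [one_mul, ← Real.rpow_add hy0]; congr 1; ring

theorem integrable_min_sq_mul_rpow {s : ℝ} (hs : 0 < s) (hs2 : s < 2) :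
    Integrable fun z : Plane => min (‖z‖ ^ 2) 1 * ‖z‖ ^ (-2 - s) := by
  simpa only [Real.rpow_two] using integrable_min_rpow_mul_rpow hs hs2

theorem integrable_min_norm_mul_rpow {s : ℝ} (hs : 0 < s) (hs1 : s < 1) :
    Integrable fun z : Plane => min ‖z‖ 1 * ‖z‖ ^ (-2 - s) := by
  simpa only [Real.rpow_one] using integrable_min_rpow_mul_rpow hs hs1

theorem one_sub_cos_inner_le (z k : Plane) :
    1 - Real.cos (inner ℝ z k) ≤ 2 * (1 + ‖k‖ ^ 2) * min (‖z‖ ^ 2) 1 := by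
  have h1 := Real.one_sub_sq_div_two_le_cos (x := inner ℝ z k)
  have h2 : (inner ℝ z k) ^ 2 ≤ ‖z‖ ^ 2 * ‖k‖ ^ 2 := by
    rw [← mul_pow, ← sq_abs]
    gcongr
    exact abs_real_inner_le_norm z k
  rcases min_cases (‖z‖ ^ 2) 1 with h | h <;> rw [h.1]
  · nlinarith [sq_nonneg ‖z‖, sq_nonneg ‖k‖, mul_nonneg (sq_nonneg ‖z‖) (sq_nonneg ‖k‖)]
  · nlinarith [Real.neg_one_le_cos (inner ℝ z k), sq_nonneg ‖k‖]

theorem integrable_one_sub_cos {s : ℝ} (hs : 0 < s) (hs2 : s < 2) (k : Plane) :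
    Integrable fun z : Plane => (1 - Real.cos (inner ℝ z k)) * ‖z‖ ^ (-2 - s) := by
  refine ((integrable_min_sq_mul_rpow hs hs2).const_mul (2 * (1 + ‖k‖ ^ 2))).mono'
    (by fun_prop) (Eventually.of_forall fun z => ?_)
  have := Real.cos_le_one (inner ℝ z k)
  rw [Real.norm_of_nonneg (mul_nonneg (by linarith) (by positivity)), ← mul_assoc]
  gcongr
  exact one_sub_cos_inner_le z k

/-- The normalising constant `∫ (1 - cos z₀) |z| ^ (-2 - s) dz` of the singular integral
for `Λ ^ s`. -/
noncomputable def lambdaConst (s : ℝ) : ℝ :=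
  ∫ z : Plane, (1 - Real.cos (inner ℝ z (EuclideanSpace.single 0 1))) * ‖z‖ ^ (-2 - s)

theorem lambdaConst_pos {s : ℝ} (hs : 0 < s) (hs2 : s < 2) : 0 < lambdaConst s := by
  have hnn : ∀ z : Plane, 0 ≤
      (1 - Real.cos (inner ℝ z (EuclideanSpace.single 0 1))) * ‖z‖ ^ (-2 - s) := fun z =>
    mul_nonneg (by linarith [Real.cos_le_one (inner ℝ z (EuclideanSpace.single 0 1))])
      (by positivity)
  rw [lambdaConst, integral_pos_iff_support_of_nonneg hnn (integrable_one_sub_cos hs hs2 _)]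
  set e : Plane := EuclideanSpace.single 0 1
  have he : ‖e‖ = 1 := by simp [e]
  have hopen : IsOpen {z : Plane | inner ℝ z e ∈ Ioo (0 : ℝ) 2} :=
    isOpen_Ioo.preimage (continuous_id.inner continuous_const)
  refine (hopen.measure_pos volume ⟨e, ?_⟩).trans_le (measure_mono fun z hz => ?_)
  · simp [he]
  · have hz0 : z ≠ 0 := by
      rintro rfl
      simp at hz
    have h1 : Real.cos (inner ℝ z e) < 1 := by
      rw [← Real.cos_zero]
      exact Real.cos_lt_cos_of_nonneg_of_le_pi le_rfl
        (hz.2.le.trans (by linarith [Real.pi_gt_three])) hz.1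
    have h2 : 0 < ‖z‖ ^ (-2 - s) := Real.rpow_pos_of_pos (norm_pos_iff.2 hz0) _
    exact (mul_pos (by linarith) h2).ne'

theorem exists_linearIsometryEquiv_map_eq (k : Plane) :
    ∃ R : Plane ≃ₗᵢ[ℝ] Plane, R k = ‖k‖ • EuclideanSpace.single 0 1 := by
  refine ⟨(ℝ ∙ (k - ‖k‖ • EuclideanSpace.single 0 1))ᗮ.reflection, ?_⟩
  exact Submodule.reflection_sub (by simp [norm_smul])

/-- `∫ (1 - cos (z · k)) |z| ^ (-2 - s) dz` is the symbol `|k| ^ s`, by rotation invariance and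
scaling. -/
theorem integral_one_sub_cos {s : ℝ} (hs : 0 < s) (k : Plane) :
    ∫ z : Plane, (1 - Real.cos (inner ℝ z k)) * ‖z‖ ^ (-2 - s) = lambdaConst s * ‖k‖ ^ s := by
  rcases eq_or_ne k 0 with rfl | hk
  · simp [Real.zero_rpow hs.ne']
  have hk0 : 0 < ‖k‖ := norm_pos_iff.2 hk
  obtain ⟨R, hR⟩ := exists_linearIsometryEquiv_map_eq k
  set e : Plane := EuclideanSpace.single 0 1
  have h1 : ∀ z : Plane, (1 - Real.cos (inner ℝ z k)) * ‖z‖ ^ (-2 - s)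
      = (fun w : Plane => (1 - Real.cos (inner ℝ (‖k‖ • w) e)) * ‖w‖ ^ (-2 - s)) (R z) := by
    intro z
    simp only [LinearIsometryEquiv.norm_map]
    rw [real_inner_smul_left, ← real_inner_smul_right, ← hR, LinearIsometryEquiv.inner_map_map]
  simp_rw [h1]
  rw [R.measurePreserving.integral_comp R.toHomeomorph.measurableEmbedding
    (fun w : Plane => (1 - Real.cos (inner ℝ (‖k‖ • w) e)) * ‖w‖ ^ (-2 - s))]
  have h2 : ∀ w : Plane, (1 - Real.cos (inner ℝ (‖k‖ • w) e)) * ‖w‖ ^ (-2 - s)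
      = ‖k‖ ^ (2 + s) *
        (fun z : Plane => (1 - Real.cos (inner ℝ z e)) * ‖z‖ ^ (-2 - s)) (‖k‖ • w) := by
    intro w
    simp only
    rw [norm_smul, norm_norm, Real.mul_rpow hk0.le (norm_nonneg w), mul_left_comm,
      ← mul_assoc (‖k‖ ^ (2 + s)), ← Real.rpow_add hk0]
    simp
  simp_rw [h2]
  rw [integral_const_mul, Measure.integral_comp_smul volume
    (fun z : Plane => (1 - Real.cos (inner ℝ z e)) * ‖z‖ ^ (-2 - s))]
  have hd : Module.finrank ℝ Plane = 2 := by simp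
  rw [hd, abs_of_pos (by positivity), smul_eq_mul, Real.rpow_add hk0, Real.rpow_two, lambdaConst]
  field_simp
  rfl

/-- Domination for the odd kernel `z |z| ^ (-3 - α)`. -/
theorem abs_inner_mul_sin_le {α : ℝ} (z v k : Plane) :
    |inner ℝ z v * Real.sin (inner ℝ z k) * ‖z‖ ^ (-3 - α)|
      ≤ ‖v‖ * (1 + ‖k‖) * (min ‖z‖ 1 * ‖z‖ ^ (-2 - α)) := by
  rcases eq_or_ne z 0 with rfl | hz
  · simp
  have hz0 : 0 < ‖z‖ := norm_pos_iff.2 hz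
  have h1 : |Real.sin (inner ℝ z k)| ≤ (1 + ‖k‖) * min ‖z‖ 1 := by
    have ha := Real.abs_sin_le_one (inner ℝ z k)
    have hb : |Real.sin (inner ℝ z k)| ≤ ‖z‖ * ‖k‖ :=
      Real.abs_sin_le_abs.trans (abs_real_inner_le_norm z k)
    rcases min_cases ‖z‖ 1 with h | h <;> rw [h.1]
    · nlinarith [norm_nonneg k]
    · nlinarith [norm_nonneg k]
  have h2 : ‖z‖ ^ (-2 - α) = ‖z‖ * ‖z‖ ^ (-3 - α) := by
    nth_rewrite 2 [← Real.rpow_one ‖z‖]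
    rw [← Real.rpow_add hz0]
    congr 1; ring
  rw [abs_mul, abs_mul, abs_of_nonneg (by positivity : 0 ≤ ‖z‖ ^ (-3 - α)), h2]
  calc _ ≤ (‖z‖ * ‖v‖) * ((1 + ‖k‖) * min ‖z‖ 1) * ‖z‖ ^ (-3 - α) := by
        gcongr; exact abs_real_inner_le_norm z v
    _ = _ := by ring

/-- The symbol of the odd kernel `z |z| ^ (-3 - α)`, obtained by differentiating
`integral_one_sub_cos` with `s = 1 + α` in the direction `v`. -/
theorem integral_inner_mul_sin {α : ℝ} (hα : 0 < α) (hα1 : α < 1) (v k : Plane) :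
    ∫ z : Plane, inner ℝ z v * Real.sin (inner ℝ z k) * ‖z‖ ^ (-3 - α)
      = lambdaConst (1 + α) * (1 + α) * ‖k‖ ^ (α - 1) * inner ℝ k v := by
  have e3 : (-2 - (1 + α)) = -3 - α := by ring
  have hder := hasDerivAt_integral_of_dominated_loc_of_deriv_le (μ := (volume : Measure Plane))
    (F := fun (t : ℝ) (z : Plane) => (1 - Real.cos (inner ℝ z (k + t • v))) * ‖z‖ ^ (-3 - α))
    (F' := fun (t : ℝ) (z : Plane) =>
      inner ℝ z v * Real.sin (inner ℝ z (k + t • v)) * ‖z‖ ^ (-3 - α))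
    (x₀ := (0 : ℝ)) (s := Metric.ball 0 1)
    (bound := fun z => ‖v‖ * (1 + (‖k‖ + ‖v‖)) * (min ‖z‖ 1 * ‖z‖ ^ (-2 - α)))
    (Metric.ball_mem_nhds 0 one_pos)
    (Eventually.of_forall fun t => by fun_prop)
    (by
      have := integrable_one_sub_cos (s := 1 + α) (by linarith) (by linarith) (k + (0 : ℝ) • v)
      rwa [e3] at this)
    (by fun_prop)
    (Eventually.of_forall fun z t ht => by
      refine (abs_inner_mul_sin_le z v _).trans ?_
      gcongr
      refine (norm_add_le _ _).trans ?_
      gcongr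
      rw [norm_smul]
      have : ‖t‖ < 1 := by simpa using ht
      nlinarith [norm_nonneg v])
    ((integrable_min_norm_mul_rpow hα hα1).const_mul _)
    (Eventually.of_forall fun z t _ => by
      have h1 : HasDerivAt (fun t : ℝ => inner ℝ z (k + t • v)) (inner ℝ z v) t := by
        simp only [inner_add_right, real_inner_smul_right]
        simpa using ((hasDerivAt_id t).mul_const (inner ℝ z v)).const_add (inner ℝ z k)
      have h2 := ((h1.cos).const_sub 1).mul_const (‖z‖ ^ (-3 - α))
      exact h2.congr_deriv (by ring))
  have hΦ : (fun t : ℝ => ∫ z : Plane, (1 - Real.cos (inner ℝ z (k + t • v))) * ‖z‖ ^ (-3 - α))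
      = fun t : ℝ => lambdaConst (1 + α) * ‖k + t • v‖ ^ (1 + α) := by
    funext t
    rw [← integral_one_sub_cos (by linarith), e3]
  have h2 := hder.2
  rw [hΦ] at h2
  have h3 : HasDerivAt (fun t : ℝ => k + t • v) v 0 := by
    simpa using ((hasDerivAt_id (0 : ℝ)).smul_const v).const_add k
  have h4 := ((hasFDerivAt_norm_rpow (k + (0 : ℝ) • v)
    (p := 1 + α) (by linarith)).comp_hasDerivAt (0 : ℝ) h3).const_mul (lambdaConst (1 + α))
  have h5 := h2.unique h4
  simp only [zero_smul, add_zero] at h5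
  rw [h5]
  simp only [smul_apply, innerSL_apply_apply, smul_eq_mul]
  rw [show 1 + α - 2 = α - 1 by ring]
  ring

/-! ### The velocity as a singular integral -/

/-- The odd singular integral `∫ (z · v) |z| ^ (-3 - α) (f (x + z) - f (x - z)) dz`; it is
absolutely convergent for bounded Lipschitz `f` when `0 < α < 1`. -/
noncomputable def oddIntegral (α : ℝ) (v : Plane) (f : Plane → ℝ) (x : Plane) : ℝ :=
  ∫ z : Plane, inner ℝ z v * ‖z‖ ^ (-3 - α) * (f (x + z) - f (x - z))

/-- The Fourier symbol of `oddIntegral α v`, as a function of the angular frequency. -/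
noncomputable def oddSymbol (α : ℝ) (v k : Plane) : ℂ :=
  2 * Complex.I * ((lambdaConst (1 + α) * (1 + α) * ‖k‖ ^ (α - 1) * inner ℝ k v : ℝ) : ℂ)

theorem fourierChar_add_sub (a b : ℝ) :
    (Real.fourierChar (a + b) : ℂ) - Real.fourierChar (a - b)
      = Real.fourierChar a * (2 * Complex.I * (Real.sin (2 * Real.pi * b) : ℂ)) := by
  simp only [Real.fourierChar_apply]
  push_cast
  rw [show ((2 * Real.pi * (a + b) : ℂ)) * Complex.I
      = 2 * Real.pi * a * Complex.I + (2 * Real.pi * b) * Complex.I by ring,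
    show ((2 * Real.pi * (a - b) : ℂ)) * Complex.I
      = 2 * Real.pi * a * Complex.I + -(2 * Real.pi * b) * Complex.I by ring,
    Complex.exp_add, Complex.exp_add, ← mul_sub, Complex.sin]
  congr 1
  linear_combination (-Complex.exp (-(2 * Real.pi * b) * Complex.I)
    + Complex.exp ((2 * Real.pi * b) * Complex.I)) * Complex.I_sq

theorem fourierChar_second_difference (a b : ℝ) :
    2 * (Real.fourierChar a : ℂ) - Real.fourierChar (a + b) - Real.fourierChar (a - b)
      = Real.fourierChar a * (2 * (1 - Real.cos (2 * Real.pi * b) : ℝ) : ℂ) := by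
  simp only [Real.fourierChar_apply]
  push_cast
  rw [show ((2 * Real.pi * (a + b) : ℂ)) * Complex.I
      = 2 * Real.pi * a * Complex.I + (2 * Real.pi * b) * Complex.I by ring,
    show ((2 * Real.pi * (a - b) : ℂ)) * Complex.I
      = 2 * Real.pi * a * Complex.I + -(2 * Real.pi * b) * Complex.I by ring,
    Complex.exp_add, Complex.exp_add, Complex.cos]
  ring

theorem fourierInv_add_sub {G : Plane → ℂ} (hG : Integrable G) (x z : Plane) :
    𝓕⁻ G (x + z) - 𝓕⁻ G (x - z) =
      𝓕⁻ (fun ζ => 2 * Complex.I * (Real.sin (inner ℝ z ((2 * Real.pi) • ζ)) : ℂ) * G ζ) x := by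
  simp only [Real.fourierInv_eq]
  rw [← integral_sub (integrable_fourierInv_integrand hG _) (integrable_fourierInv_integrand hG _)]
  refine integral_congr_ae (Eventually.of_forall fun ζ => ?_)
  simp only [Circle.smul_def, smul_eq_mul, inner_add_right, inner_sub_right]
  rw [← sub_mul, fourierChar_add_sub, real_inner_smul_right, real_inner_comm z ζ]
  ring

theorem fourierInv_second_difference {G : Plane → ℂ} (hG : Integrable G) (x z : Plane) :
    2 * 𝓕⁻ G x - 𝓕⁻ G (x + z) - 𝓕⁻ G (x - z) =
      𝓕⁻ (fun ζ => ((2 * (1 - Real.cos (inner ℝ z ((2 * Real.pi) • ζ))) : ℝ) : ℂ) * G ζ) x := by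
  simp only [Real.fourierInv_eq]
  have h2 : Integrable fun ζ : Plane => (2 : ℂ) * Real.fourierChar (inner ℝ ζ x) • G ζ :=
    (integrable_fourierInv_integrand hG x).const_mul 2
  have h3 : Integrable fun ζ : Plane => (2 : ℂ) * Real.fourierChar (inner ℝ ζ x) • G ζ
      - Real.fourierChar (inner ℝ ζ (x + z)) • G ζ :=
    h2.sub (integrable_fourierInv_integrand hG _)
  rw [← integral_const_mul, ← integral_sub h2 (integrable_fourierInv_integrand hG _),
    ← integral_sub h3 (integrable_fourierInv_integrand hG _)]
  refine integral_congr_ae (Eventually.of_forall fun ζ => ?_)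
  simp only [Circle.smul_def, smul_eq_mul, inner_add_right, inner_sub_right]
  have h := fourierChar_second_difference (inner ℝ ζ x) (inner ℝ ζ z)
  rw [real_inner_smul_right, real_inner_comm ζ z]
  push_cast at h ⊢
  linear_combination G ζ * h

theorem abs_rpow_mul_inner_le {α : ℝ} (hα : 0 < α) (hα1 : α < 1) (v k : Plane) :
    |‖k‖ ^ (α - 1) * inner ℝ k v| ≤ ‖v‖ * (1 + ‖k‖) := by
  rcases eq_or_ne k 0 with rfl | hk
  · simp
  have hk0 : 0 < ‖k‖ := norm_pos_iff.2 hk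
  rw [abs_mul, abs_of_nonneg (by positivity : 0 ≤ ‖k‖ ^ (α - 1))]
  have h1 : ‖k‖ ^ (α - 1) * ‖k‖ ≤ 1 + ‖k‖ := by
    nth_rewrite 2 [← Real.rpow_one ‖k‖]
    rw [← Real.rpow_add hk0, sub_add_cancel]
    rcases le_total ‖k‖ 1 with h | h
    · have := Real.rpow_le_one hk0.le h hα.le
      linarith
    · have := Real.rpow_le_rpow_of_exponent_le h hα1.le
      rw [Real.rpow_one] at this
      linarith
  calc _ ≤ ‖k‖ ^ (α - 1) * (‖k‖ * ‖v‖) := by gcongr; exact abs_real_inner_le_norm k v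
    _ = ‖v‖ * (‖k‖ ^ (α - 1) * ‖k‖) := by ring
    _ ≤ _ := by gcongr

theorem integrable_oddSymbol_mul {α : ℝ} (hα : 0 < α) (hα1 : α < 1) {G : Plane → ℂ}
    (hG : Integrable G) (hG' : Integrable fun ζ => ‖ζ‖ * ‖G ζ‖) (v : Plane) :
    Integrable fun ζ => oddSymbol α v ((2 * Real.pi) • ζ) * G ζ := by
  have hL := lambdaConst_pos (s := 1 + α) (by linarith) (by linarith)
  refine ((hG.norm.add (hG'.const_mul (2 * Real.pi))).const_mul
    (2 * (lambdaConst (1 + α) * (1 + α)) * ‖v‖)).mono' ?_ (Eventually.of_forall fun ζ => ?_)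
  · refine AEStronglyMeasurable.mul ?_ hG.aestronglyMeasurable
    unfold oddSymbol
    fun_prop
  · have h := abs_rpow_mul_inner_le hα hα1 v ((2 * Real.pi) • ζ)
    rw [norm_smul (2 * Real.pi) ζ, Real.norm_of_nonneg Real.two_pi_pos.le] at h
    rw [norm_mul, oddSymbol, norm_mul, Complex.norm_real, Real.norm_eq_abs,
      mul_assoc _ _ (inner _ _ _), abs_mul,
      abs_of_nonneg (by positivity : 0 ≤ lambdaConst (1 + α) * (1 + α)), norm_smul (2 * Real.pi) ζ,
      Real.norm_of_nonneg Real.two_pi_pos.le]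
    simp only [norm_mul, Complex.norm_I, Complex.norm_ofNat, mul_one, Pi.add_apply]
    calc _ ≤ 2 * (lambdaConst (1 + α) * (1 + α) * (‖v‖ * (1 + 2 * Real.pi * ‖ζ‖))) * ‖G ζ‖ := by
          gcongr
      _ = _ := by ring

theorem oddIntegral_eq_fourierInv {α : ℝ} (hα : 0 < α) (hα1 : α < 1) {f : Plane → ℝ}
    {G : Plane → ℂ} (hf : ∀ x, (f x : ℂ) = 𝓕⁻ G x)
    (hG : Integrable G) (hG' : Integrable fun ζ => ‖ζ‖ * ‖G ζ‖) (v x : Plane) :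
    (oddIntegral α v f x : ℂ) = 𝓕⁻ (fun ζ => oddSymbol α v ((2 * Real.pi) • ζ) * G ζ) x := by
  have h1 : ∀ z : Plane, ((inner ℝ z v * ‖z‖ ^ (-3 - α) * (f (x + z) - f (x - z)) : ℝ) : ℂ)
      = ∫ ζ, ((inner ℝ z v * Real.sin (inner ℝ z ((2 * Real.pi) • ζ)) * ‖z‖ ^ (-3 - α) : ℝ) : ℂ)
        * (2 * Complex.I * (Real.fourierChar (inner ℝ ζ x) * G ζ)) := by
    intro z
    push_cast
    rw [hf, hf, fourierInv_add_sub hG, Real.fourierInv_eq, ← integral_const_mul]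
    refine integral_congr_ae (Eventually.of_forall fun ζ => ?_)
    simp only [Circle.smul_def, smul_eq_mul]
    push_cast
    ring
  have hG2 : Integrable fun ζ => 2 * Complex.I * (Real.fourierChar (inner ℝ ζ x) * G ζ) := by
    have := (integrable_fourierInv_integrand hG x).const_mul (2 * Complex.I)
    simpa only [Circle.smul_def, smul_eq_mul] using this
  have hint : Integrable (Function.uncurry fun (z ζ : Plane) =>
      ((inner ℝ z v * Real.sin (inner ℝ z ((2 * Real.pi) • ζ)) * ‖z‖ ^ (-3 - α) : ℝ) : ℂ)
        * (2 * Complex.I * (Real.fourierChar (inner ℝ ζ x) * G ζ))) (volume.prod volume) := by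
    have hb := ((integrable_min_norm_mul_rpow hα hα1).const_mul ‖v‖).mul_prod
      ((hG.norm.add (hG'.const_mul (2 * Real.pi))).const_mul 2)
    refine hb.mono' ?_ (Eventually.of_forall fun ⟨z, ζ⟩ => ?_)
    · refine AEStronglyMeasurable.mul ?_ hG2.aestronglyMeasurable.comp_snd
      exact Measurable.aestronglyMeasurable (by fun_prop)
    · simp only [Function.uncurry_apply_pair, norm_mul, Complex.norm_real, Complex.norm_I,
        Complex.norm_ofNat, Circle.norm_coe, Pi.add_apply, mul_one, one_mul]
      have h := abs_inner_mul_sin_le (α := α) z v ((2 * Real.pi) • ζ)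
      rw [norm_smul (2 * Real.pi) ζ, Real.norm_of_nonneg Real.two_pi_pos.le] at h
      rw [← norm_mul, ← norm_mul, Real.norm_eq_abs]
      calc _ ≤ ‖v‖ * (1 + 2 * Real.pi * ‖ζ‖) * (min ‖z‖ 1 * ‖z‖ ^ (-2 - α)) * (2 * ‖G ζ‖) := by
            gcongr
        _ = _ := by ring
  rw [oddIntegral, ← integral_complex_ofReal]
  simp_rw [h1]
  rw [integral_integral_swap hint, Real.fourierInv_eq]
  refine integral_congr_ae (Eventually.of_forall fun ζ => ?_)
  simp only
  rw [integral_mul_const, integral_complex_ofReal, integral_inner_mul_sin hα hα1, oddSymbol,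
    Circle.smul_def, smul_eq_mul]
  ring

theorem continuous_oddIntegral {α : ℝ} (hα : 0 < α) (hα1 : α < 1) {f : Plane → ℝ}
    {G : Plane → ℂ} (hf : ∀ x, (f x : ℂ) = 𝓕⁻ G x)
    (hG : Integrable G) (hG' : Integrable fun ζ => ‖ζ‖ * ‖G ζ‖) (v : Plane) :
    Continuous (oddIntegral α v f) := by
  have : oddIntegral α v f =
      fun x => (𝓕⁻ (fun ζ => oddSymbol α v ((2 * Real.pi) • ζ) * G ζ) x).re := by
    funext x
    rw [← oddIntegral_eq_fourierInv hα hα1 hf hG hG', Complex.ofReal_re]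
  rw [this]
  exact Complex.continuous_re.comp
    (continuous_fourierInv (integrable_oddSymbol_mul hα hα1 hG hG' v))

/-- A Fourier multiplier with symbol `c · oddSymbol α v` is `c · oddIntegral α v`. -/
theorem IsFourierMultiplier.ae_eq_oddIntegral {α : ℝ} (hα : 0 < α) (hα1 : α < 1) {f g : Plane → ℝ}
    {G : Plane → ℂ} {σ : Plane → ℂ} (h : IsFourierMultiplier σ f g) (v : Plane) (c : ℝ)
    (hσ : ∀ k, σ k = c * oddSymbol α v k)
    (hfG : ∀ hf : MemLp (fun x => (f x : ℂ)) 2 (volume : Measure Plane),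
      (𝓕 (hf.toLp _) : L2) =ᵐ[volume] G) (hf : ∀ x, (f x : ℂ) = 𝓕⁻ G x)
    (hG : Integrable G) (hG' : Integrable fun ζ => ‖ζ‖ * ‖G ζ‖) :
    ∀ᵐ x, g x = c * oddIntegral α v f x := by
  obtain ⟨hf2, hg2, hmul⟩ := h
  have hi := integrable_oddSymbol_mul hα hα1 hG hG' v
  have e : (𝓕 (hg2.toLp _) : L2) =ᵐ[volume]
      fun ζ => (c : ℂ) * (oddSymbol α v ((2 * Real.pi) • ζ) * G ζ) := by
    filter_upwards [hmul, hfG hf2] with ζ h1 h2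
    rw [h1, h2, hσ, mul_assoc]
  have h1 := ae_eq_fourierInv e (hi.const_mul _)
  filter_upwards [h1, hg2.coeFn_toLp] with x hx hx'
  rw [hx', Real.fourierInv_eq] at hx
  simp only [Circle.smul_def, smul_eq_mul, mul_left_comm _ (c : ℂ)] at hx
  rw [integral_const_mul] at hx
  have h2 := oddIntegral_eq_fourierInv hα hα1 hf hG hG' v x
  rw [Real.fourierInv_eq] at h2
  simp only [Circle.smul_def, smul_eq_mul] at h2
  rw [← h2] at hx
  exact_mod_cast hx

/-- The coefficient with which `oddIntegral` represents the velocity `Λ ^ α R^⊥ f`. -/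
noncomputable def velocityConst (α : ℝ) : ℝ := (2 * (lambdaConst (1 + α) * (1 + α)))⁻¹

theorem velocityConst_pos {α : ℝ} (hα : 0 < α) (hα1 : α < 1) : 0 < velocityConst α := by
  have hL := lambdaConst_pos (s := 1 + α) (by linarith) (by linarith)
  unfold velocityConst
  positivity

/-- The representative of the velocity `Λ ^ α R^⊥ f` given by singular integrals. -/
noncomputable def velocity (α : ℝ) (f : Plane → ℝ) (x : Plane) : Plane :=
  velocityConst α • !₂[oddIntegral α (EuclideanSpace.single 1 1) f x,
    -oddIntegral α (EuclideanSpace.single 0 1) f x]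

theorem lambdaSymbol_mul_rieszSymbol {α : ℝ} (hα : 0 < α) (hα1 : α < 1) (j : Fin 2) (k : Plane) :
    lambdaSymbol α k * -rieszSymbol j k
      = (velocityConst α : ℂ) * oddSymbol α (EuclideanSpace.single j 1) k := by
  have hL := (lambdaConst_pos (s := 1 + α) (by linarith) (by linarith)).ne'
  have h1 : ‖k‖ ^ α * (k j / ‖k‖) = ‖k‖ ^ (α - 1) * k j := by
    rcases eq_or_ne k 0 with rfl | hk
    · simp
    rw [Real.rpow_sub_one (norm_ne_zero_iff.2 hk)]
    ring
  have h2 : velocityConst α * (2 * (lambdaConst (1 + α) * (1 + α))) = 1 := by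
    unfold velocityConst
    exact inv_mul_cancel₀ (by positivity)
  have h2' : (velocityConst α : ℂ) * (2 * (lambdaConst (1 + α) * (1 + α))) = 1 := by
    exact_mod_cast h2
  have h1' : ((‖k‖ ^ α : ℝ) : ℂ) * ((k j / ‖k‖ : ℝ) : ℂ)
      = ((‖k‖ ^ (α - 1) : ℝ) : ℂ) * (k j : ℂ) := by
    exact_mod_cast congrArg ((↑) : ℝ → ℂ) h1
  have h3 : inner ℝ k (EuclideanSpace.single j (1 : ℝ)) = k j := by
    simp [EuclideanSpace.inner_single_right]
  rw [lambdaSymbol, rieszSymbol, oddSymbol, h3]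
  push_cast at h1' ⊢
  linear_combination Complex.I * h1' - Complex.I * ((‖k‖ ^ (α - 1) : ℝ) : ℂ) * (k j : ℂ) * h2'

theorem IsVelocity.ae_eq_velocity {α : ℝ} (hα : 0 < α) (hα1 : α < 1) {f : Plane → ℝ}
    {u : Plane → Plane} (h : IsVelocity α f u) {G : Plane → ℂ}
    (hfG : ∀ hf : MemLp (fun x => (f x : ℂ)) 2 (volume : Measure Plane),
      (𝓕 (hf.toLp _) : L2) =ᵐ[volume] G) (hf : ∀ x, (f x : ℂ) = 𝓕⁻ G x)
    (hG : Integrable G) (hG' : Integrable fun ζ => ‖ζ‖ * ‖G ζ‖) :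
    ∀ᵐ x, u x = velocity α f x := by
  have h0 := h.1.ae_eq_oddIntegral hα hα1 (EuclideanSpace.single 1 1) (velocityConst α)
    (lambdaSymbol_mul_rieszSymbol hα hα1 1) hfG hf hG hG'
  have h1 := h.2.ae_eq_oddIntegral hα hα1 (EuclideanSpace.single 0 1) (-velocityConst α)
    (fun k => by
      have := lambdaSymbol_mul_rieszSymbol hα hα1 0 k
      push_cast
      linear_combination -this) hfG hf hG hG'
  filter_upwards [h0, h1] with x hx0 hx1
  ext j
  fin_cases j
  · simpa [velocity] using hx0
  · simpa [velocity] using hx1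

theorem continuous_velocity {α : ℝ} (hα : 0 < α) (hα1 : α < 1) {f : Plane → ℝ}
    {G : Plane → ℂ} (hf : ∀ x, (f x : ℂ) = 𝓕⁻ G x)
    (hG : Integrable G) (hG' : Integrable fun ζ => ‖ζ‖ * ‖G ζ‖) : Continuous (velocity α f) := by
  have h0 := continuous_oddIntegral hα hα1 hf hG hG' (EuclideanSpace.single 0 1)
  have h1 := continuous_oddIntegral hα hα1 hf hG hG' (EuclideanSpace.single 1 1)
  have h : Continuous fun x => !₂[oddIntegral α (EuclideanSpace.single 1 1) f x,
      -oddIntegral α (EuclideanSpace.single 0 1) f x] := by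
    refine (PiLp.continuous_toLp 2 fun _ : Fin 2 => ℝ).comp (continuous_pi fun j => ?_)
    fin_cases j
    · exact h1
    · exact h0.neg
  exact h.const_smul (velocityConst α)

/-! ### The fractional Laplacian as a singular integral -/

/-- The even singular integral `∫ (2 f(x) - f(x + z) - f(x - z)) |z| ^ (-2 - β) dz`, a positive
multiple of `Λ ^ β f`; it is absolutely convergent for bounded `C²` functions when
`0 < β < 2`. -/
noncomputable def evenIntegral (β : ℝ) (f : Plane → ℝ) (x : Plane) : ℝ :=
  ∫ z : Plane, (2 * f x - f (x + z) - f (x - z)) * ‖z‖ ^ (-2 - β)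

theorem exists_second_difference_le {f : Plane → ℝ} (hf : ContDiff ℝ 2 f) {B : ℝ}
    (hB : ∀ x, |f x| ≤ B) {K : Set Plane} (hK : IsCompact K) :
    ∃ M : ℝ, 0 ≤ M ∧ ∀ x ∈ K, ∀ z,
      |2 * f x - f (x + z) - f (x - z)| ≤ M * min (‖z‖ ^ 2) 1 := by
  have hB0 : 0 ≤ B := (abs_nonneg _).trans (hB 0)
  obtain ⟨R, hR⟩ := hK.isBounded.subset_closedBall (0 : Plane)
  have hf1 : ContDiff ℝ 1 (fderiv ℝ f) := hf.fderiv_right (by norm_num)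
  obtain ⟨M, hM⟩ := (isCompact_closedBall (0 : Plane) (R + 1)).exists_bound_of_continuousOn
    (hf1.continuous_fderiv (by norm_num)).continuousOn
  have hlip : ∀ a ∈ Metric.closedBall (0 : Plane) (R + 1),
      ∀ b ∈ Metric.closedBall (0 : Plane) (R + 1),
      ‖fderiv ℝ f a - fderiv ℝ f b‖ ≤ M * ‖a - b‖ := fun a ha b hb =>
    (convex_closedBall (0 : Plane) (R + 1)).norm_image_sub_le_of_norm_fderiv_le
      (fun c _ => (hf1.differentiable (by norm_num)) c) hM hb ha
  refine ⟨2 * |M| + 4 * B, by positivity, fun x hx z => ?_⟩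
  rcases le_or_gt ‖z‖ 1 with hz | hz
  · have hx' : ‖x‖ ≤ R := by simpa using hR hx
    have hder : ∀ w, HasFDerivAt (fun w => f (x + w) + f (x - w))
        (fderiv ℝ f (x + w) - fderiv ℝ f (x - w)) w := by
      intro w
      have hd := hf.differentiable (by norm_num)
      have h1 : HasFDerivAt (fun w => f (x + w)) (fderiv ℝ f (x + w)) w :=
        ((hd (x + w)).hasFDerivAt).comp w ((hasFDerivAt_id w).const_add x)
      have h2 : HasFDerivAt (fun w => f (x - w)) (-fderiv ℝ f (x - w)) w := by
        have := ((hd (x - w)).hasFDerivAt).comp w ((hasFDerivAt_id w).const_sub x)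
        rw [ContinuousLinearMap.comp_neg, ContinuousLinearMap.comp_id] at this
        exact this
      exact (h1.add h2).congr_fderiv (sub_eq_add_neg _ _).symm
    have h := (convex_closedBall (0 : Plane) ‖z‖).norm_image_sub_le_of_norm_hasFDerivWithin_le
      (f := fun w => f (x + w) + f (x - w)) (C := 2 * |M| * ‖z‖) (x := 0) (y := z)
      (fun w _ => (hder w).hasFDerivWithinAt) (fun w hw => by
        have hw' : ‖w‖ ≤ ‖z‖ := by simpa using hw
        have ha : x + w ∈ Metric.closedBall (0 : Plane) (R + 1) := by
          rw [mem_closedBall_zero_iff]; linarith [norm_add_le x w]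
        have hb : x - w ∈ Metric.closedBall (0 : Plane) (R + 1) := by
          rw [mem_closedBall_zero_iff]; linarith [norm_sub_le x w]
        refine (hlip _ ha _ hb).trans ?_
        have e : x + w - (x - w) = (2 : ℝ) • w := by rw [two_smul]; abel
        rw [e, norm_smul, Real.norm_ofNat]
        have := le_abs_self M
        nlinarith [mul_le_mul_of_nonneg_right this (norm_nonneg w),
          mul_le_mul_of_nonneg_left hw' (abs_nonneg M)]) (by simp) (by simp)
    simp only [add_zero, sub_zero, Real.norm_eq_abs] at h
    rw [min_eq_left (by nlinarith [norm_nonneg z])]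
    have e : 2 * f x - f (x + z) - f (x - z) = -(f (x + z) + f (x - z) - (f x + f x)) := by ring
    rw [e, abs_neg]
    nlinarith [sq_nonneg ‖z‖, mul_nonneg hB0 (sq_nonneg ‖z‖)]
  · rw [min_eq_right (by nlinarith), mul_one]
    have h1 := abs_le.1 (hB x)
    have h2 := abs_le.1 (hB (x + z))
    have h3 := abs_le.1 (hB (x - z))
    rw [abs_le]
    constructor <;> linarith [abs_nonneg M, h1.1, h1.2]

theorem integrable_evenIntegral {β : ℝ} (hβ : 0 < β) (hβ2 : β < 2) {f : Plane → ℝ}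
    (hf : ContDiff ℝ 2 f) {B : ℝ} (hB : ∀ x, |f x| ≤ B) (x : Plane) :
    Integrable fun z : Plane => (2 * f x - f (x + z) - f (x - z)) * ‖z‖ ^ (-2 - β) := by
  obtain ⟨M, -, hM⟩ := exists_second_difference_le hf hB (isCompact_singleton (x := x))
  have hc := hf.continuous
  refine ((integrable_min_sq_mul_rpow hβ hβ2).const_mul M).mono'
    (Measurable.aestronglyMeasurable (by fun_prop))
    (Eventually.of_forall fun z => ?_)
  rw [norm_mul, Real.norm_of_nonneg (by positivity : 0 ≤ ‖z‖ ^ (-2 - β)), ← mul_assoc]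
  gcongr
  exact hM x rfl z

theorem continuous_evenIntegral {β : ℝ} (hβ : 0 < β) (hβ2 : β < 2) {f : Plane → ℝ}
    (hf : ContDiff ℝ 2 f) {B : ℝ} (hB : ∀ x, |f x| ≤ B) : Continuous (evenIntegral β f) := by
  have hc := hf.continuous
  refine continuous_iff_continuousAt.2 fun x₀ => ?_
  obtain ⟨M, -, hM⟩ := exists_second_difference_le hf hB (isCompact_closedBall x₀ 1)
  refine continuousAt_of_dominated (bound := fun z => M * (min (‖z‖ ^ 2) 1 * ‖z‖ ^ (-2 - β)))
    (Eventually.of_forall fun x => Measurable.aestronglyMeasurable (by fun_prop)) ?_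
    ((integrable_min_sq_mul_rpow hβ hβ2).const_mul M)
    (Eventually.of_forall fun z => by fun_prop)
  filter_upwards [Metric.closedBall_mem_nhds x₀ one_pos] with x hx
  refine Eventually.of_forall fun z => ?_
  rw [norm_mul, Real.norm_of_nonneg (by positivity : 0 ≤ ‖z‖ ^ (-2 - β)), ← mul_assoc]
  gcongr
  exact hM x hx z

/-- Tested against a smooth compactly supported function, `evenIntegral β f` acts as the Fourier
multiplier `2 · lambdaConst β · |k| ^ β`. -/
theorem integral_mul_evenIntegral {β : ℝ} (hβ : 0 < β) (hβ2 : β < 2) {f : Plane → ℝ}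
    (hf : ContDiff ℝ 2 f) {B : ℝ} (hB : ∀ x, |f x| ≤ B) {G : Plane → ℂ}
    (hfG : ∀ x, (f x : ℂ) = 𝓕⁻ G x) (hG : Integrable G)
    (φ : SchwartzMap Plane ℂ) (hφ : HasCompactSupport φ) :
    ∫ x, φ x * (evenIntegral β f x : ℂ)
      = ∫ ζ, 𝓕⁻ (φ : Plane → ℂ) ζ *
        (((2 * lambdaConst β * ‖(2 * Real.pi) • ζ‖ ^ β : ℝ) : ℂ) * G ζ) := by
  have hc := hf.continuous
  obtain ⟨M, hM0, hM⟩ := exists_second_difference_le hf hB hφ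
  have hφi : Integrable φ := φ.integrable
  have hint₁ : Integrable (Function.uncurry fun (x z : Plane) =>
      φ x * (((2 * f x - f (x + z) - f (x - z)) * ‖z‖ ^ (-2 - β) : ℝ) : ℂ))
      (volume.prod volume) := by
    refine (hφi.norm.mul_prod ((integrable_min_sq_mul_rpow hβ hβ2).const_mul M)).mono' ?_
      (Eventually.of_forall fun ⟨x, z⟩ => ?_)
    · refine AEStronglyMeasurable.mul hφi.aestronglyMeasurable.comp_fst ?_
      exact Measurable.aestronglyMeasurable (by fun_prop)
    · simp only [Function.uncurry_apply_pair, norm_mul, Complex.norm_real]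
      by_cases hx : x ∈ tsupport φ
      · rw [Real.norm_of_nonneg (by positivity : 0 ≤ ‖z‖ ^ (-2 - β)), Real.norm_eq_abs,
          ← mul_assoc M]
        gcongr
        exact hM x hx z
      · rw [image_eq_zero_of_notMem_tsupport hx]
        simp
  have h1 : ∀ z : Plane,
      ∫ x, φ x * (((2 * f x - f (x + z) - f (x - z)) * ‖z‖ ^ (-2 - β) : ℝ) : ℂ)
      = ∫ ζ, ((2 * ((1 - Real.cos (inner ℝ z ((2 * Real.pi) • ζ))) * ‖z‖ ^ (-2 - β)) : ℝ) : ℂ) *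
        (𝓕⁻ (φ : Plane → ℂ) ζ * G ζ) := by
    intro z
    have hGz : Integrable fun ζ : Plane =>
        ((2 * (1 - Real.cos (inner ℝ z ((2 * Real.pi) • ζ))) : ℝ) : ℂ) * G ζ := by
      refine (hG.norm.const_mul 4).mono' (AEStronglyMeasurable.mul
        (Measurable.aestronglyMeasurable (by fun_prop)) hG.aestronglyMeasurable)
        (Eventually.of_forall fun ζ => ?_)
      rw [norm_mul, Complex.norm_real]
      gcongr
      have ha := Real.cos_le_one (inner ℝ z ((2 * Real.pi) • ζ))
      have hb := Real.neg_one_le_cos (inner ℝ z ((2 * Real.pi) • ζ))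
      rw [Real.norm_of_nonneg (by linarith)]
      linarith
    have h := integral_mul_fourierInv_eq hφi hGz
    simp_rw [← fourierInv_second_difference hG, ← hfG] at h
    calc _ = ∫ x, (‖z‖ ^ (-2 - β) : ℝ) *
          (φ x * (2 * (f x : ℂ) - (f (x + z) : ℂ) - (f (x - z) : ℂ))) :=
          integral_congr_ae (Eventually.of_forall fun x => by simp only; push_cast; ring)
      _ = (‖z‖ ^ (-2 - β) : ℝ) * ∫ ζ, 𝓕⁻ (φ : Plane → ℂ) ζ *
            (((2 * (1 - Real.cos (inner ℝ z ((2 * Real.pi) • ζ))) : ℝ) : ℂ) * G ζ) := by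
          rw [integral_const_mul, h]
      _ = _ := by
          rw [← integral_const_mul]
          exact integral_congr_ae (Eventually.of_forall fun ζ => by simp only; push_cast; ring)
  obtain ⟨C₀, hC₀⟩ := (𝓕⁻ φ).decay 0 0
  obtain ⟨C₂, hC₂⟩ := (𝓕⁻ φ).decay 2 0
  obtain ⟨-, hC₀⟩ := hC₀
  obtain ⟨-, hC₂⟩ := hC₂
  simp only [norm_iteratedFDeriv_zero, pow_zero, one_mul, SchwartzMap.fourierInv_coe] at hC₀ hC₂
  have hφc : Continuous (𝓕⁻ (φ : Plane → ℂ)) := continuous_fourierInv hφi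
  have hint₂ : Integrable (Function.uncurry fun (z ζ : Plane) =>
      ((2 * ((1 - Real.cos (inner ℝ z ((2 * Real.pi) • ζ))) * ‖z‖ ^ (-2 - β)) : ℝ) : ℂ) *
        (𝓕⁻ (φ : Plane → ℂ) ζ * G ζ)) (volume.prod volume) := by
    refine ((integrable_min_sq_mul_rpow hβ hβ2).mul_prod
      (hG.norm.const_mul (4 * (C₀ + (2 * Real.pi) ^ 2 * C₂)))).mono' ?_
      (Eventually.of_forall fun ⟨z, ζ⟩ => ?_)
    · refine AEStronglyMeasurable.mul (Measurable.aestronglyMeasurable (by fun_prop)) ?_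
      exact (hφc.aestronglyMeasurable.mul hG.aestronglyMeasurable).comp_snd
    · simp only [Function.uncurry_apply_pair, norm_mul, Complex.norm_real]
      have ha := Real.cos_le_one (inner ℝ z ((2 * Real.pi) • ζ))
      have hb := one_sub_cos_inner_le z ((2 * Real.pi) • ζ)
      rw [norm_smul, mul_pow, Real.norm_of_nonneg Real.two_pi_pos.le] at hb
      rw [Real.norm_of_nonneg (by positivity : 0 ≤ ‖z‖ ^ (-2 - β)), Real.norm_ofNat,
        Real.norm_of_nonneg (by linarith : 0 ≤ 1 - Real.cos (inner ℝ z ((2 * Real.pi) • ζ)))]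
      have h4 : (1 + (2 * Real.pi) ^ 2 * ‖ζ‖ ^ 2) * ‖𝓕⁻ (φ : Plane → ℂ) ζ‖
          ≤ C₀ + (2 * Real.pi) ^ 2 * C₂ := by
        nlinarith [hC₀ ζ, mul_le_mul_of_nonneg_left (hC₂ ζ) (sq_nonneg (2 * Real.pi))]
      calc _ ≤ 2 * (2 * (1 + (2 * Real.pi) ^ 2 * ‖ζ‖ ^ 2) * min (‖z‖ ^ 2) 1 * ‖z‖ ^ (-2 - β)) *
            (‖𝓕⁻ (φ : Plane → ℂ) ζ‖ * ‖G ζ‖) := by gcongr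
        _ = min (‖z‖ ^ 2) 1 * ‖z‖ ^ (-2 - β) * (4 * ((1 + (2 * Real.pi) ^ 2 * ‖ζ‖ ^ 2) *
            ‖𝓕⁻ (φ : Plane → ℂ) ζ‖) * ‖G ζ‖) := by ring
        _ ≤ _ := by gcongr
  calc _ = ∫ x, ∫ z, φ x * (((2 * f x - f (x + z) - f (x - z)) * ‖z‖ ^ (-2 - β) : ℝ) : ℂ) := by
        refine integral_congr_ae (Eventually.of_forall fun x => ?_)
        simp only
        rw [integral_const_mul, integral_complex_ofReal]; rfl
    _ = ∫ ζ, ∫ z, ((2 * ((1 - Real.cos (inner ℝ z ((2 * Real.pi) • ζ))) *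
          ‖z‖ ^ (-2 - β)) : ℝ) : ℂ) * (𝓕⁻ (φ : Plane → ℂ) ζ * G ζ) := by
        rw [integral_integral_swap hint₁]
        simp_rw [h1]
        rw [integral_integral_swap hint₂]
    _ = _ := by
        refine integral_congr_ae (Eventually.of_forall fun ζ => ?_)
        simp only
        rw [integral_mul_const, integral_complex_ofReal, integral_const_mul,
          integral_one_sub_cos hβ]
        push_cast
        ring

/-- The singular integral representation of `Λ ^ β`. It is obtained by duality, because
`|ζ| ^ β 𝓕 f` need not be integrable. -/
theorem IsFracLaplacian.ae_eq_evenIntegral {β : ℝ} (hβ : 0 < β) (hβ2 : β < 2) {f g : Plane → ℝ}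
    (h : IsFracLaplacian β f g) (hf : ContDiff ℝ 2 f) {B : ℝ} (hB : ∀ x, |f x| ≤ B)
    {G : Plane → ℂ} (hfF : ∀ hf : MemLp (fun x => (f x : ℂ)) 2 (volume : Measure Plane),
      (𝓕 (hf.toLp _) : L2) =ᵐ[volume] G)
    (hfG : ∀ x, (f x : ℂ) = 𝓕⁻ G x) (hG : Integrable G) :
    ∀ᵐ x, g x = (2 * lambdaConst β)⁻¹ * evenIntegral β f x := by
  have hL := lambdaConst_pos hβ hβ2
  obtain ⟨hf2, hg2, hmul⟩ := h
  have hcont : Continuous fun x =>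
      (((2 * lambdaConst β)⁻¹ * evenIntegral β f x : ℝ) : ℂ) :=
    Complex.continuous_ofReal.comp (continuous_const.mul (continuous_evenIntegral hβ hβ2 hf hB))
  have key : ∀ᵐ x, (hg2.toLp _ : L2) x =
      (((2 * lambdaConst β)⁻¹ * evenIntegral β f x : ℝ) : ℂ) := by
    refine ae_eq_of_integral_contDiff_smul_eq ((Lp.memLp _).locallyIntegrable (by norm_num))
      hcont.locallyIntegrable fun φ hφ hc => ?_
    have hc' : HasCompactSupport fun x => (φ x : ℂ) := hc.comp_left (g := ((↑) : ℝ → ℂ)) rfl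
    have hφ' : ContDiff ℝ (⊤ : ℕ∞) fun x => (φ x : ℂ) := Complex.ofRealCLM.contDiff.comp hφ
    have h1 := integral_schwartz_mul_eq (hc'.toSchwartzMap hφ') (hg2.toLp _)
    have h2 := integral_mul_evenIntegral hβ hβ2 hf hB hfG hG (hc'.toSchwartzMap hφ') hc'
    have h3 : ∫ x, φ x • (((2 * lambdaConst β)⁻¹ * evenIntegral β f x : ℝ) : ℂ)
        = (((2 * lambdaConst β)⁻¹ : ℝ) : ℂ) *
          ∫ x, (hc'.toSchwartzMap hφ') x * (evenIntegral β f x : ℂ) := by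
      rw [← integral_const_mul]
      refine integral_congr_ae (Eventually.of_forall fun x => ?_)
      simp only
      rw [show (hc'.toSchwartzMap hφ') x = (φ x : ℂ) from rfl, Complex.real_smul]
      push_cast
      ring
    rw [h3, h2]
    simp only [Complex.real_smul]
    refine Eq.trans h1 ?_
    rw [← integral_const_mul]
    refine integral_congr_ae ?_
    filter_upwards [hmul, hfF hf2] with ζ hζ hζ'
    rw [hζ, hζ', lambdaSymbol]
    have : (((2 * lambdaConst β)⁻¹ : ℝ) : ℂ) * ((2 * lambdaConst β : ℝ) : ℂ) = 1 := by
      rw [← Complex.ofReal_mul, inv_mul_cancel₀ (by positivity), Complex.ofReal_one]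
    rw [Complex.ofReal_mul (2 * lambdaConst β)]
    linear_combination -(𝓕⁻ ((hc'.toSchwartzMap hφ' : SchwartzMap Plane ℂ) : Plane → ℂ) ζ) *
      ((‖(2 * Real.pi) • ζ‖ ^ β : ℝ) : ℂ) * G ζ * this
  filter_upwards [key, hg2.coeFn_toLp] with x hx hx'
  rw [hx'] at hx
  exact_mod_cast hx

/-! ### The velocity increment and the dissipation at a touching pair -/

theorem integrable_max_norm_one_rpow {q : ℝ} (hq : 2 < q) :
    Integrable fun w : Plane => max ‖w‖ 1 ^ (-q) := by
  have h := (integrable_one_add_norm (E := Plane) (μ := volume) (r := q)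
    (by simpa using hq)).const_mul (2 ^ q)
  refine h.mono' (Measurable.aestronglyMeasurable (by fun_prop))
    (Eventually.of_forall fun w => ?_)
  have h0 : 0 < max ‖w‖ 1 := lt_max_of_lt_right one_pos
  rw [Real.norm_of_nonneg (by positivity)]
  calc max ‖w‖ 1 ^ (-q) ≤ ((1 + ‖w‖) / 2) ^ (-q) :=
        Real.rpow_le_rpow_of_nonpos (by positivity)
          (by linarith [le_max_left ‖w‖ 1, le_max_right ‖w‖ 1]) (by linarith)
    _ = 2 ^ q * (1 + ‖w‖) ^ (-q) := by
        rw [Real.div_rpow (by positivity) (by norm_num), Real.rpow_neg (by norm_num : (0 : ℝ) ≤ 2),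
          div_inv_eq_mul, mul_comm]

theorem max_norm_rpow_eq {q ξ : ℝ} (hξ : 0 < ξ) (z : Plane) :
    max ‖z‖ ξ ^ (-q) = ξ ^ (-q) * max ‖ξ⁻¹ • z‖ 1 ^ (-q) := by
  rw [← Real.mul_rpow hξ.le (le_max_of_le_right zero_le_one), mul_max_of_nonneg _ _ hξ.le,
    norm_smul, norm_inv, Real.norm_of_nonneg hξ.le, mul_inv_cancel_left₀ hξ.ne', mul_one]

theorem integrable_max_norm_rpow {q ξ : ℝ} (hq : 2 < q) (hξ : 0 < ξ) :
    Integrable fun z : Plane => max ‖z‖ ξ ^ (-q) := by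
  simp_rw [max_norm_rpow_eq hξ]
  exact ((integrable_max_norm_one_rpow hq).comp_smul (inv_ne_zero hξ.ne')).const_mul _

theorem integral_max_norm_rpow {q ξ : ℝ} (hξ : 0 < ξ) :
    ∫ z : Plane, max ‖z‖ ξ ^ (-q) = ξ ^ (2 - q) * ∫ w : Plane, max ‖w‖ 1 ^ (-q) := by
  simp_rw [max_norm_rpow_eq hξ]
  rw [integral_const_mul, Measure.integral_comp_smul volume
    (fun w : Plane => max ‖w‖ 1 ^ (-q))]
  have hd : Module.finrank ℝ Plane = 2 := by simp
  rw [hd, abs_of_pos (by positivity), smul_eq_mul, sub_eq_add_neg, Real.rpow_add hξ, Real.rpow_two]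
  simp only [inv_pow, inv_inv]
  ring

theorem abs_rpow_neg_sub_le {p c a b : ℝ} (hp : 0 < p) (hc : 0 < c) (ha : c ≤ a) (hb : c ≤ b) :
    |a ^ (-p) - b ^ (-p)| ≤ p * c ^ (-p - 1) * |a - b| := by
  have h := (convex_Ici c).norm_image_sub_le_of_norm_hasDerivWithin_le
    (f := fun x : ℝ => x ^ (-p)) (f' := fun x : ℝ => -p * x ^ (-p - 1)) (C := p * c ^ (-p - 1))
    (fun x hx => (Real.hasDerivAt_rpow_const (Or.inl (hc.trans_le hx).ne')).hasDerivWithinAt)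
    (fun x hx => by
      have hx0 : 0 < x := hc.trans_le hx
      rw [norm_mul, norm_neg, Real.norm_of_nonneg hp.le, Real.norm_of_nonneg (by positivity)]
      gcongr p * ?_
      exact Real.rpow_le_rpow_of_nonpos hc hx (by linarith)) hb ha
  simpa only [Real.norm_eq_abs] using h

/-- The kernel `z |z| ^ (-p)` flattened at scale `ξ` is Lipschitz, with a constant that decays like
`|z| ^ (-p)`. -/
theorem abs_flattened_kernel_sub_le {p ξ : ℝ} (hp : 0 < p) (hξ : 0 < ξ) (v z h : Plane)
    (hh : ‖h‖ ≤ ξ) :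
    |inner ℝ z v * max ‖z‖ ξ ^ (-p) - inner ℝ (z + h) v * max ‖z + h‖ ξ ^ (-p)|
      ≤ ‖v‖ * (p * 2 ^ (p + 1) + 2 ^ p) * ξ * max ‖z‖ ξ ^ (-p) := by
  set a := max ‖z‖ ξ with ha
  set b := max ‖z + h‖ ξ with hb
  have ha0 : 0 < a := lt_max_of_lt_right hξ
  have hb0 : 0 < b := lt_max_of_lt_right hξ
  have hab : |a - b| ≤ ξ := by
    refine (abs_max_sub_max_le_abs ‖z‖ ‖z + h‖ ξ).trans ((abs_norm_sub_norm_le _ _).trans ?_)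
    simpa using hh
  have hξb : ξ ≤ b := le_max_right _ _
  have hb2 : a / 2 ≤ b := by linarith [(abs_le.1 hab).2]
  have h1 : b ^ (-p) ≤ 2 ^ p * a ^ (-p) := by
    refine (Real.rpow_le_rpow_of_nonpos (by positivity) hb2 (by linarith)).trans (le_of_eq ?_)
    rw [Real.div_rpow ha0.le (by norm_num), Real.rpow_neg (by norm_num : (0 : ℝ) ≤ 2),
      div_inv_eq_mul, mul_comm]
  have h2 : a * |a ^ (-p) - b ^ (-p)| ≤ p * 2 ^ (p + 1) * ξ * a ^ (-p) := by
    calc a * |a ^ (-p) - b ^ (-p)| ≤ a * (p * (a / 2) ^ (-p - 1) * ξ) := by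
          gcongr
          refine (abs_rpow_neg_sub_le hp (half_pos ha0) (by linarith) hb2).trans ?_
          gcongr
      _ = p * 2 ^ (p + 1) * ξ * (a * a ^ (-p - 1)) := by
          rw [Real.div_rpow ha0.le (by norm_num), show -p - 1 = -(p + 1) by ring,
            Real.rpow_neg (by norm_num : (0 : ℝ) ≤ 2), div_inv_eq_mul]
          ring
      _ = _ := by
          rw [Real.rpow_sub_one ha0.ne', mul_div_cancel₀ _ ha0.ne']
  have e : inner ℝ z v * a ^ (-p) - inner ℝ (z + h) v * b ^ (-p)
      = inner ℝ z v * (a ^ (-p) - b ^ (-p)) - inner ℝ h v * b ^ (-p) := by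
    rw [inner_add_left]; ring
  rw [e]
  calc _ ≤ |inner ℝ z v| * |a ^ (-p) - b ^ (-p)| + |inner ℝ h v| * b ^ (-p) := by
        refine (abs_sub _ _).trans (le_of_eq ?_)
        rw [abs_mul, abs_mul, abs_of_nonneg (by positivity : 0 ≤ b ^ (-p))]
    _ ≤ (a * ‖v‖) * |a ^ (-p) - b ^ (-p)| + (ξ * ‖v‖) * (2 ^ p * a ^ (-p)) := by
        gcongr
        · exact (abs_real_inner_le_norm z v).trans (by gcongr; exact le_max_left _ _)
        · exact (abs_real_inner_le_norm h v).trans (by gcongr)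
    _ = ‖v‖ * (a * |a ^ (-p) - b ^ (-p)|) + ‖v‖ * (2 ^ p * ξ * a ^ (-p)) := by ring
    _ ≤ ‖v‖ * (p * 2 ^ (p + 1) * ξ * a ^ (-p)) + ‖v‖ * (2 ^ p * ξ * a ^ (-p)) := by gcongr
    _ = _ := by ring

theorem integrable_oddIntegral {α B M : ℝ} (hα : 0 < α) (hα1 : α < 1) {f : Plane → ℝ}
    (hf : Continuous f) (hB : ∀ x, |f x| ≤ B) (hM : ∀ a b, |f a - f b| ≤ M * ‖a - b‖)
    (v x : Plane) :
    Integrable fun z : Plane => inner ℝ z v * ‖z‖ ^ (-3 - α) * (f (x + z) - f (x - z)) := by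
  have hB0 : 0 ≤ B := (abs_nonneg _).trans (hB 0)
  refine ((integrable_min_norm_mul_rpow hα hα1).const_mul (‖v‖ * (2 * |M| + 2 * B))).mono'
    (Measurable.aestronglyMeasurable (by fun_prop)) (Eventually.of_forall fun z => ?_)
  rcases eq_or_ne z 0 with rfl | hz
  · simp
  have hz0 : 0 < ‖z‖ := norm_pos_iff.2 hz
  have h1 : |f (x + z) - f (x - z)| ≤ (2 * |M| + 2 * B) * min ‖z‖ 1 := by
    rcases min_cases ‖z‖ 1 with h | h <;> rw [h.1]
    · have ha := hM (x + z) (x - z)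
      rw [show x + z - (x - z) = (2 : ℝ) • z by rw [two_smul]; abel, norm_smul,
        Real.norm_ofNat] at ha
      nlinarith [mul_le_mul_of_nonneg_right (le_abs_self M) hz0.le, mul_nonneg hB0 hz0.le]
    · have ha := (abs_sub (f (x + z)) (f (x - z))).trans (add_le_add (hB _) (hB _))
      linarith [abs_nonneg M]
  have h2 : ‖z‖ ^ (-2 - α) = ‖z‖ * ‖z‖ ^ (-3 - α) := by
    nth_rewrite 2 [← Real.rpow_one ‖z‖]
    rw [← Real.rpow_add hz0]
    congr 1; ring
  rw [norm_mul, norm_mul, Real.norm_of_nonneg (by positivity : 0 ≤ ‖z‖ ^ (-3 - α)),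
    Real.norm_eq_abs, Real.norm_eq_abs, h2]
  calc _ ≤ (‖z‖ * ‖v‖) * ‖z‖ ^ (-3 - α) * ((2 * |M| + 2 * B) * min ‖z‖ 1) := by
        gcongr
        exact abs_real_inner_le_norm z v
    _ = _ := by ring

/-- The power modulus `A ξ ^ γ` dominates the oscillation of `f` and is attained at the pair
`x, y`. -/
structure IsTouching (A γ : ℝ) (f : Plane → ℝ) (x y : Plane) : Prop where
  ne : x ≠ y
  sub_le : ∀ a b, f a - f b ≤ A * ‖a - b‖ ^ γ
  eq : f x - f y = A * ‖x - y‖ ^ γ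

/-- The defect `A |x - y| ^ γ - (f(x + z) - f(y + z))` of the modulus, for translates of the pair
`x, y`. -/
noncomputable def defect (A γ : ℝ) (f : Plane → ℝ) (x y z : Plane) : ℝ :=
  A * ‖x - y‖ ^ γ - (f (x + z) - f (y + z))

/-- The even part (doubled) of the defect. -/
noncomputable def evenDefect (A γ : ℝ) (f : Plane → ℝ) (x y z : Plane) : ℝ :=
  defect A γ f x y z + defect A γ f x y (-z)

/-- The dissipation `∫ S(z) |z| ^ (-2 - β) dz` gained at a touching pair. -/
noncomputable def dissipation (A γ β : ℝ) (f : Plane → ℝ) (x y : Plane) : ℝ :=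
  ∫ z, evenDefect A γ f x y z * ‖z‖ ^ (-2 - β)

namespace IsTouching

variable {A γ α β B : ℝ} {f : Plane → ℝ} {x y : Plane}

theorem norm_pos (h : IsTouching A γ f x y) : 0 < ‖x - y‖ := norm_sub_pos_iff.2 h.ne

theorem defect_nonneg (h : IsTouching A γ f x y) (z : Plane) : 0 ≤ defect A γ f x y z := by
  have := h.sub_le (x + z) (y + z)
  rw [add_sub_add_right_eq_sub] at this
  unfold defect
  linarith

theorem evenDefect_nonneg (h : IsTouching A γ f x y) (z : Plane) : 0 ≤ evenDefect A γ f x y z :=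
  add_nonneg (h.defect_nonneg z) (h.defect_nonneg (-z))

theorem evenDefect_zero (h : IsTouching A γ f x y) : evenDefect A γ f x y 0 = 0 := by
  simp [evenDefect, defect, h.eq]

theorem evenDefect_eq (h : IsTouching A γ f x y) (z : Plane) :
    evenDefect A γ f x y z
      = (2 * f x - f (x + z) - f (x - z)) - (2 * f y - f (y + z) - f (y - z)) := by
  simp only [evenDefect, defect, ← sub_eq_add_neg, ← h.eq]
  ring

theorem integrable_evenDefect (h : IsTouching A γ f x y) (hβ : 0 < β) (hβ2 : β < 2)
    (hf : ContDiff ℝ 2 f) (hB : ∀ x, |f x| ≤ B) :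
    Integrable fun z => evenDefect A γ f x y z * ‖z‖ ^ (-2 - β) := by
  simp_rw [h.evenDefect_eq]
  have := (integrable_evenIntegral hβ hβ2 hf hB x).sub (integrable_evenIntegral hβ hβ2 hf hB y)
  simpa only [Pi.sub_def, ← sub_mul] using! this

theorem evenIntegral_sub (h : IsTouching A γ f x y) (hβ : 0 < β) (hβ2 : β < 2)
    (hf : ContDiff ℝ 2 f) (hB : ∀ x, |f x| ≤ B) :
    evenIntegral β f x - evenIntegral β f y = dissipation A γ β f x y := by
  rw [evenIntegral, evenIntegral, ← integral_sub (integrable_evenIntegral hβ hβ2 hf hB x)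
    (integrable_evenIntegral hβ hβ2 hf hB y), dissipation]
  simp_rw [h.evenDefect_eq, sub_mul]

/-- Two consecutive increments of length `|x - y|` telescope to one increment of length
`2 |x - y|`, which the modulus bounds by `2 ^ γ < 2` times its value at `|x - y|`; so the two
defects cannot both be small. -/
theorem le_evenDefect_add (h : IsTouching A γ f x y) (z : Plane) :
    (2 - 2 ^ γ) * (A * ‖x - y‖ ^ γ)
      ≤ evenDefect A γ f x y z + evenDefect A γ f x y (z + (x - y)) := by
  have h1 := h.sub_le (x + (z + (x - y))) (y + z)
  have e1 : x + (z + (x - y)) - (y + z) = (2 : ℝ) • (x - y) := by rw [two_smul]; abel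
  have e2 : y + (z + (x - y)) = x + z := by abel
  rw [e1, norm_smul, Real.norm_ofNat, Real.mul_rpow (by norm_num) (norm_nonneg _)] at h1
  have h2 := h.defect_nonneg (-z)
  have h3 := h.defect_nonneg (-(z + (x - y)))
  have h4 : (2 - 2 ^ γ) * (A * ‖x - y‖ ^ γ)
      ≤ defect A γ f x y z + defect A γ f x y (z + (x - y)) := by
    unfold defect
    rw [e2]
    linarith
  unfold evenDefect
  linarith

theorem le_evenDefect_mul (h : IsTouching A γ f x y) (hβ : 0 < β) {z : Plane} {r : ℝ}
    (hz : ‖z‖ ≤ r) :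
    evenDefect A γ f x y z * r ^ (-2 - β) ≤ evenDefect A γ f x y z * ‖z‖ ^ (-2 - β) := by
  rcases eq_or_ne z 0 with rfl | hz0
  · rw [h.evenDefect_zero, zero_mul, zero_mul]
  · exact mul_le_mul_of_nonneg_left
      (Real.rpow_le_rpow_of_nonpos (norm_pos_iff.2 hz0) hz (by linarith)) (h.evenDefect_nonneg z)

end IsTouching

/-- The constant in the lower bound of the dissipation. -/
noncomputable def dissipationConst (γ β : ℝ) : ℝ :=
  2⁻¹ * ((2 - 2 ^ γ) * 2 ^ (-2 - β) * volume.real (Metric.ball (0 : Plane) 1))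

theorem dissipationConst_pos {γ β : ℝ} (hγ1 : γ < 1) : 0 < dissipationConst γ β := by
  have h1 : (2 : ℝ) ^ γ < 2 := by
    have := Real.rpow_lt_rpow_of_exponent_lt (x := 2) (by norm_num) hγ1
    rwa [Real.rpow_one] at this
  have h2 : 0 < volume.real (Metric.ball (0 : Plane) 1) :=
    ENNReal.toReal_pos (Metric.measure_ball_pos volume 0 one_pos).ne' measure_ball_lt_top.ne
  have h3 : 0 < 2 - (2 : ℝ) ^ γ := by linarith
  unfold dissipationConst
  positivity

namespace IsTouching

variable {A γ α β B M : ℝ} {f : Plane → ℝ} {x y : Plane}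

theorem le_dissipation (h : IsTouching A γ f x y) (hβ : 0 < β) (hβ2 : β < 2)
    (hf : ContDiff ℝ 2 f) (hB : ∀ x, |f x| ≤ B) :
    dissipationConst γ β * (A * ‖x - y‖ ^ (γ - β)) ≤ dissipation A γ β f x y := by
  set ξ := ‖x - y‖ with hξdef
  have hξ : 0 < ξ := h.norm_pos
  have hi := h.integrable_evenDefect hβ hβ2 hf hB
  have hi2 := hi.comp_add_right (x - y)
  have key : ∫ z in Metric.ball (0 : Plane) ξ, (2 - 2 ^ γ) * (A * ξ ^ γ) * (2 * ξ) ^ (-2 - β)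
      ≤ ∫ z, (evenDefect A γ f x y z * ‖z‖ ^ (-2 - β)
        + evenDefect A γ f x y (z + (x - y)) * ‖z + (x - y)‖ ^ (-2 - β)) := by
    rw [← integral_indicator measurableSet_ball]
    refine integral_mono ?_ (hi.add hi2) fun z => ?_
    · exact (integrableOn_const measure_ball_lt_top.ne).integrable_indicator measurableSet_ball
    · simp only [indicator]
      split_ifs with hz
      · have hz' : ‖z‖ < ξ := by simpa using hz
        have h1 := h.le_evenDefect_mul hβ (z := z) (r := 2 * ξ) (by linarith)
        have h2 := h.le_evenDefect_mul hβ (z := z + (x - y)) (r := 2 * ξ)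
          ((norm_add_le _ _).trans (by linarith))
        have h3 := mul_le_mul_of_nonneg_right (h.le_evenDefect_add z)
          (by positivity : 0 ≤ (2 * ξ) ^ (-2 - β))
        rw [add_mul] at h3
        linarith
      · exact add_nonneg (mul_nonneg (h.evenDefect_nonneg _) (by positivity))
          (mul_nonneg (h.evenDefect_nonneg _) (by positivity))
  rw [integral_add hi hi2, integral_add_right_eq_self
    (fun z => evenDefect A γ f x y z * ‖z‖ ^ (-2 - β)), setIntegral_const, smul_eq_mul] at key
  have hvol : volume.real (Metric.ball (0 : Plane) ξ)
      = ξ ^ 2 * volume.real (Metric.ball (0 : Plane) 1) := by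
    rw [Measure.real, Measure.addHaar_ball _ _ hξ.le, ENNReal.toReal_mul,
      ENNReal.toReal_ofReal (by positivity)]
    simp [Measure.real]
  rw [hvol, Real.mul_rpow (by norm_num) hξ.le] at key
  have hpow : ξ ^ (γ - β) = ξ ^ 2 * ξ ^ γ * ξ ^ (-2 - β) := by
    rw [← Real.rpow_two, ← Real.rpow_add hξ, ← Real.rpow_add hξ]
    congr 1; ring
  rw [dissipationConst, hpow]
  unfold dissipation
  linarith

theorem dissipation_pos (h : IsTouching A γ f x y) (hA : 0 < A) (hγ1 : γ < 1)
    (hβ : 0 < β) (hβ2 : β < 2) (hf : ContDiff ℝ 2 f) (hB : ∀ x, |f x| ≤ B) :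
    0 < dissipation A γ β f x y := by
  have h1 := dissipationConst_pos (β := β) hγ1
  have h2 : 0 < ‖x - y‖ ^ (γ - β) := Real.rpow_pos_of_pos h.norm_pos _
  exact lt_of_lt_of_le (by positivity) (h.le_dissipation hβ hβ2 hf hB)

theorem abs_defect_sub_le (h : IsTouching A γ f x y) (z : Plane) :
    |defect A γ f x y (-z) - defect A γ f x y z| ≤ evenDefect A γ f x y z := by
  have h1 := h.defect_nonneg z
  have h2 := h.defect_nonneg (-z)
  unfold evenDefect
  rw [abs_le]
  constructor <;> linarith

/-- The singular part of the odd kernel only sees the odd part of the defect, so it is absorbed by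
the dissipation. -/
theorem near_le (h : IsTouching A γ f x y) (hα : 0 < α) (hαβ : α < β) (v z : Plane) :
    |inner ℝ z v * (‖z‖ ^ (-(3 + α)) - max ‖z‖ ‖x - y‖ ^ (-(3 + α))) *
        (defect A γ f x y (-z) - defect A γ f x y z)|
      ≤ ‖v‖ * ‖x - y‖ ^ (β - α) * (evenDefect A γ f x y z * ‖z‖ ^ (-2 - β)) := by
  have hS := h.evenDefect_nonneg z
  rcases eq_or_ne z 0 with rfl | hz
  · simp only [inner_zero_left, zero_mul, abs_zero]
    positivity
  have hz0 : 0 < ‖z‖ := norm_pos_iff.2 hz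
  rcases le_total ‖x - y‖ ‖z‖ with hle | hle
  · rw [max_eq_left hle, sub_self, mul_zero, zero_mul, abs_zero]
    positivity
  rw [max_eq_right hle, abs_mul, abs_mul]
  have h1 : |‖z‖ ^ (-(3 + α)) - ‖x - y‖ ^ (-(3 + α))| ≤ ‖z‖ ^ (-(3 + α)) := by
    have := Real.rpow_le_rpow_of_nonpos hz0 hle (by linarith : -(3 + α) ≤ 0)
    have h0 : 0 ≤ ‖x - y‖ ^ (-(3 + α)) := by positivity
    rw [abs_of_nonneg (by linarith)]
    linarith
  have h2 : ‖z‖ * ‖z‖ ^ (-(3 + α)) ≤ ‖x - y‖ ^ (β - α) * ‖z‖ ^ (-2 - β) := by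
    calc ‖z‖ * ‖z‖ ^ (-(3 + α)) = ‖z‖ ^ (β - α) * ‖z‖ ^ (-2 - β) := by
          nth_rewrite 1 [← Real.rpow_one ‖z‖]
          rw [← Real.rpow_add hz0, ← Real.rpow_add hz0]
          congr 1; ring
      _ ≤ _ := by gcongr
  calc _ ≤ (‖z‖ * ‖v‖) * ‖z‖ ^ (-(3 + α)) * evenDefect A γ f x y z := by
        gcongr
        · exact abs_real_inner_le_norm z v
        · exact h.abs_defect_sub_le z
    _ = ‖v‖ * evenDefect A γ f x y z * (‖z‖ * ‖z‖ ^ (-(3 + α))) := by ring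
    _ ≤ ‖v‖ * evenDefect A γ f x y z * (‖x - y‖ ^ (β - α) * ‖z‖ ^ (-2 - β)) := by gcongr
    _ = _ := by ring

end IsTouching

theorem integrable_flattened_kernel {α ξ : ℝ} (hα : 0 < α) (hξ : 0 < ξ) (v : Plane) :
    Integrable fun z : Plane => inner ℝ z v * max ‖z‖ ξ ^ (-(3 + α)) := by
  refine ((integrable_max_norm_rpow (q := 2 + α) (by linarith) hξ).const_mul ‖v‖).mono'
    (Measurable.aestronglyMeasurable (by fun_prop)) (Eventually.of_forall fun z => ?_)
  have hm : 0 < max ‖z‖ ξ := lt_max_of_lt_right hξ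
  rw [norm_mul, Real.norm_eq_abs, Real.norm_of_nonneg (by positivity)]
  calc _ ≤ (max ‖z‖ ξ * ‖v‖) * max ‖z‖ ξ ^ (-(3 + α)) := by
        gcongr
        exact (abs_real_inner_le_norm z v).trans (by gcongr; exact le_max_left _ _)
    _ = ‖v‖ * (max ‖z‖ ξ ^ (1 : ℝ) * max ‖z‖ ξ ^ (-(3 + α))) := by rw [Real.rpow_one]; ring
    _ = _ := by rw [← Real.rpow_add hm]; congr 2; ring

theorem integrable_mul_of_bounded {ψ g : Plane → ℝ} (hψ : Integrable ψ) (hg : Continuous g) {B : ℝ}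
    (hB : ∀ z, |g z| ≤ B) : Integrable fun z => ψ z * g z := by
  refine (hψ.norm.mul_const B).mono' (hψ.aestronglyMeasurable.mul hg.aestronglyMeasurable)
    (Eventually.of_forall fun z => ?_)
  rw [norm_mul]
  gcongr
  exact hB z

/-- The constant in the bound of the far part of the velocity increment. -/
noncomputable def farConst (α : ℝ) : ℝ :=
  2 * (((3 + α) * 2 ^ (3 + α + 1) + 2 ^ (3 + α)) * ∫ w : Plane, max ‖w‖ 1 ^ (-(2 + α)))

theorem farConst_nonneg {α : ℝ} (hα : 0 < α) : 0 ≤ farConst α := by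
  have : 0 ≤ ∫ w : Plane, max ‖w‖ 1 ^ (-(2 + α)) :=
    integral_nonneg fun w => Real.rpow_nonneg (le_max_of_le_right zero_le_one) _
  unfold farConst
  positivity

namespace IsTouching

variable {A γ α β B M : ℝ} {f : Plane → ℝ} {x y : Plane}

/-- Because the flattened kernel is odd and integrable, its integral against the odd part of the
defect is an integral of increments of `f` from `x` alone, with the translation by `x - y` moved
onto the kernel. -/
theorem integral_flattened_eq (hα : 0 < α) (hne : x ≠ y) (hf : Continuous f)
    (hB : ∀ x, |f x| ≤ B) (v : Plane) :
    ∫ z : Plane, inner ℝ z v * max ‖z‖ ‖x - y‖ ^ (-(3 + α)) *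
        (defect A γ f x y (-z) - defect A γ f x y z)
      = 2 * ∫ z : Plane, (inner ℝ z v * max ‖z‖ ‖x - y‖ ^ (-(3 + α))
        - inner ℝ (z + (x - y)) v * max ‖z + (x - y)‖ ‖x - y‖ ^ (-(3 + α))) *
        (f (x + z) - f x) := by
  set ψ : Plane → ℝ := fun z => inner ℝ z v * max ‖z‖ ‖x - y‖ ^ (-(3 + α)) with hψdef
  have hψ : Integrable ψ := integrable_flattened_kernel hα (norm_sub_pos_iff.2 hne) v
  have hψneg : ∀ z, ψ (-z) = -ψ z := fun z => by simp [hψdef, inner_neg_left]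
  have hb : ∀ a b, |f a - f b| ≤ B + B := fun a b =>
    (abs_sub _ _).trans (add_le_add (hB a) (hB b))
  have i1 : Integrable fun z => ψ z * (f (x + z) - f (y + z)) :=
    integrable_mul_of_bounded hψ (by fun_prop) fun z => hb _ _
  have i2 : Integrable fun z => ψ z * (f (x + -z) - f (y + -z)) :=
    integrable_mul_of_bounded hψ (by fun_prop) fun z => hb _ _
  have i3 : Integrable fun z => ψ z * (f (x + z) - f x) :=
    integrable_mul_of_bounded hψ (by fun_prop) fun z => hb _ _
  have i4 : Integrable fun z => ψ z * (f (y + z) - f x) :=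
    integrable_mul_of_bounded hψ (by fun_prop) fun z => hb _ _
  have i5 : Integrable fun z => ψ (z + (x - y)) * (f (x + z) - f x) :=
    integrable_mul_of_bounded (hψ.comp_add_right (x - y)) (by fun_prop) fun z => hb _ _
  have e1 : ∫ z, ψ z * (defect A γ f x y (-z) - defect A γ f x y z)
      = (∫ z, ψ z * (f (x + z) - f (y + z))) - ∫ z, ψ z * (f (x + -z) - f (y + -z)) := by
    rw [← integral_sub i1 i2]
    refine integral_congr_ae (Eventually.of_forall fun z => ?_)
    simp only [defect]
    ring
  have e2 : ∫ z, ψ z * (f (x + -z) - f (y + -z)) = -∫ z, ψ z * (f (x + z) - f (y + z)) := by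
    rw [← integral_neg_eq_self, ← integral_neg]
    refine integral_congr_ae (Eventually.of_forall fun z => ?_)
    simp only [hψneg, neg_neg]
    ring
  have e3 : ∫ z, ψ z * (f (x + z) - f (y + z))
      = (∫ z, ψ z * (f (x + z) - f x)) - ∫ z, ψ z * (f (y + z) - f x) := by
    rw [← integral_sub i3 i4]
    refine integral_congr_ae (Eventually.of_forall fun z => ?_)
    simp only
    ring
  have e4 : ∫ z, ψ z * (f (y + z) - f x) = ∫ z, ψ (z + (x - y)) * (f (x + z) - f x) := by
    rw [← integral_add_right_eq_self (fun z => ψ z * (f (y + z) - f x)) (x - y)]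
    refine integral_congr_ae (Eventually.of_forall fun z => ?_)
    simp only
    rw [show y + (z + (x - y)) = x + z by abel]
  have e5 : (∫ z, ψ z * (f (x + z) - f x)) - ∫ z, ψ (z + (x - y)) * (f (x + z) - f x)
      = ∫ z, (ψ z - ψ (z + (x - y))) * (f (x + z) - f x) := by
    rw [← integral_sub i3 i5]
    refine integral_congr_ae (Eventually.of_forall fun z => ?_)
    simp only
    ring
  rw [e1, e2, e3, e4, e5]
  ring

theorem abs_sub_le_max (h : IsTouching A γ f x y) (hA : 0 ≤ A) (hγ : 0 < γ) (hγ1 : γ < 1)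
    (z : Plane) : |f (x + z) - f x| ≤ A * ‖x - y‖ ^ (γ - 1) * max ‖z‖ ‖x - y‖ := by
  have hξ := h.norm_pos
  set m := max ‖z‖ ‖x - y‖ with hm
  have hm0 : 0 < m := lt_max_of_lt_right hξ
  have h1 : ‖z‖ ^ γ ≤ ‖x - y‖ ^ (γ - 1) * m := by
    calc ‖z‖ ^ γ ≤ m ^ γ := by gcongr; exact le_max_left _ _
      _ = m ^ (γ - 1) * m := by rw [Real.rpow_sub_one hm0.ne', div_mul_cancel₀ _ hm0.ne']
      _ ≤ _ := by
        refine mul_le_mul_of_nonneg_right ?_ hm0.le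
        exact Real.rpow_le_rpow_of_nonpos hξ (le_max_right _ _) (by linarith)
  have h2 : |f (x + z) - f x| ≤ A * ‖z‖ ^ γ := by
    have ha := h.sub_le (x + z) x
    have hb := h.sub_le x (x + z)
    rw [add_sub_cancel_left] at ha
    rw [sub_add_cancel_left, norm_neg] at hb
    rw [abs_le]
    constructor <;> linarith
  calc _ ≤ A * ‖z‖ ^ γ := h2
    _ ≤ A * (‖x - y‖ ^ (γ - 1) * m) := by gcongr
    _ = _ := by ring

theorem abs_integral_flattened_le (h : IsTouching A γ f x y) (hA : 0 ≤ A) (hγ : 0 < γ)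
    (hγ1 : γ < 1) (hα : 0 < α) (hf : Continuous f) (hB : ∀ x, |f x| ≤ B) (v : Plane) :
    |∫ z : Plane, inner ℝ z v * max ‖z‖ ‖x - y‖ ^ (-(3 + α)) *
        (defect A γ f x y (-z) - defect A γ f x y z)|
      ≤ ‖v‖ * farConst α * (A * ‖x - y‖ ^ (γ - α)) := by
  have hξ := h.norm_pos
  rw [integral_flattened_eq hα h.ne hf hB v, abs_mul, abs_of_pos (by norm_num : (0 : ℝ) < 2)]
  -- The constant of `abs_flattened_kernel_sub_le` with `p = 3 + α`.
  set C := (3 + α) * 2 ^ (3 + α + 1) + 2 ^ (3 + α) with hC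
  have hC0 : 0 ≤ C := by positivity
  have hb := norm_integral_le_of_norm_le
    ((integrable_max_norm_rpow (q := 2 + α) (by linarith) hξ).const_mul
      (‖v‖ * C * (A * ‖x - y‖ ^ γ)))
    (f := fun z : Plane => (inner ℝ z v * max ‖z‖ ‖x - y‖ ^ (-(3 + α))
        - inner ℝ (z + (x - y)) v * max ‖z + (x - y)‖ ‖x - y‖ ^ (-(3 + α))) *
        (f (x + z) - f x))
    (Eventually.of_forall fun z => by
      have hm : 0 < max ‖z‖ ‖x - y‖ := lt_max_of_lt_right hξ
      rw [norm_mul, Real.norm_eq_abs, Real.norm_eq_abs]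
      calc _ ≤ (‖v‖ * C * ‖x - y‖ * max ‖z‖ ‖x - y‖ ^ (-(3 + α))) *
            (A * ‖x - y‖ ^ (γ - 1) * max ‖z‖ ‖x - y‖) := by
            gcongr
            · exact abs_flattened_kernel_sub_le (by linarith) hξ v z (x - y) le_rfl
            · exact h.abs_sub_le_max hA hγ hγ1 z
        _ = ‖v‖ * C * (A * (‖x - y‖ ^ (γ - 1) * ‖x - y‖)) *
            (max ‖z‖ ‖x - y‖ ^ (-(3 + α)) * max ‖z‖ ‖x - y‖ ^ (1 : ℝ)) := by
            rw [Real.rpow_one]; ring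
        _ = _ := by
            rw [← Real.rpow_add hm, Real.rpow_sub_one hξ.ne', div_mul_cancel₀ _ hξ.ne']
            congr 2; ring)
  rw [integral_const_mul, integral_max_norm_rpow hξ, Real.norm_eq_abs] at hb
  calc _ ≤ 2 * (‖v‖ * C * (A * ‖x - y‖ ^ γ) * (‖x - y‖ ^ (2 - (2 + α)) *
        ∫ w : Plane, max ‖w‖ 1 ^ (-(2 + α)))) := by gcongr
    _ = ‖v‖ * farConst α * (A * (‖x - y‖ ^ γ * ‖x - y‖ ^ (2 - (2 + α)))) := by
        rw [farConst]; ring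
    _ = _ := by
        rw [← Real.rpow_add hξ]
        congr 3; ring

/-- At a touching pair, the increment of the odd singular integral is controlled by the
dissipation. -/
theorem abs_oddIntegral_sub_le (h : IsTouching A γ f x y) (hA : 0 ≤ A) (hγ : 0 < γ)
    (hγ1 : γ < 1) (hα : 0 < α) (hα1 : α < 1) (hαβ : α < β) (hβ2 : β < 2)
    (hf : ContDiff ℝ 2 f) (hB : ∀ x, |f x| ≤ B) (hM : ∀ a b, |f a - f b| ≤ M * ‖a - b‖)
    (v : Plane) :
    |oddIntegral α v f x - oddIntegral α v f y|
      ≤ ‖v‖ * (1 + farConst α / dissipationConst γ β) * ‖x - y‖ ^ (β - α) *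
        dissipation A γ β f x y := by
  have hξ := h.norm_pos
  have hβ : 0 < β := hα.trans hαβ
  have hc := hf.continuous
  have hdc := dissipationConst_pos (β := β) hγ1
  have hSi := h.integrable_evenDefect hβ hβ2 hf hB
  set E : Plane → ℝ := fun z => defect A γ f x y (-z) - defect A γ f x y z with hE
  have hEc : Continuous E := by
    simp only [hE, defect]
    fun_prop
  have hEB : ∀ z, |E z| ≤ 4 * B := by
    intro z
    have h1 := abs_le.1 (hB (x + z))
    have h2 := abs_le.1 (hB (y + z))
    have h3 := abs_le.1 (hB (x + -z))
    have h4 := abs_le.1 (hB (y + -z))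
    simp only [hE, defect]
    rw [abs_le]
    constructor <;> linarith [h1.1, h1.2, h2.1, h2.2, h3.1, h3.2, h4.1, h4.2]
  have hdiff := integral_sub (integrable_oddIntegral hα hα1 hc hB hM v x)
    (integrable_oddIntegral hα hα1 hc hB hM v y)
  have hnear : Integrable fun z : Plane =>
      inner ℝ z v * (‖z‖ ^ (-(3 + α)) - max ‖z‖ ‖x - y‖ ^ (-(3 + α))) * E z := by
    refine (hSi.const_mul (‖v‖ * ‖x - y‖ ^ (β - α))).mono'
      (Measurable.aestronglyMeasurable (by fun_prop)) (Eventually.of_forall fun z => ?_)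
    exact h.near_le hα hαβ v z
  have hfar : Integrable fun z : Plane =>
      inner ℝ z v * max ‖z‖ ‖x - y‖ ^ (-(3 + α)) * E z :=
    integrable_mul_of_bounded (integrable_flattened_kernel hα hξ v) hEc hEB
  have hsplit : oddIntegral α v f x - oddIntegral α v f y
      = (∫ z : Plane, inner ℝ z v * (‖z‖ ^ (-(3 + α)) - max ‖z‖ ‖x - y‖ ^ (-(3 + α))) * E z)
        + ∫ z : Plane, inner ℝ z v * max ‖z‖ ‖x - y‖ ^ (-(3 + α)) * E z := by
    rw [oddIntegral, oddIntegral, ← hdiff, ← integral_add hnear hfar]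
    refine integral_congr_ae (Eventually.of_forall fun z => ?_)
    simp only [hE, defect, ← sub_eq_add_neg]
    rw [show -3 - α = -(3 + α) by ring]
    ring
  have hn : |∫ z : Plane, inner ℝ z v * (‖z‖ ^ (-(3 + α)) - max ‖z‖ ‖x - y‖ ^ (-(3 + α))) * E z|
      ≤ ‖v‖ * ‖x - y‖ ^ (β - α) * dissipation A γ β f x y := by
    have := norm_integral_le_of_norm_le (hSi.const_mul (‖v‖ * ‖x - y‖ ^ (β - α)))
      (f := fun z : Plane =>
        inner ℝ z v * (‖z‖ ^ (-(3 + α)) - max ‖z‖ ‖x - y‖ ^ (-(3 + α))) * E z)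
      (Eventually.of_forall fun z => h.near_le hα hαβ v z)
    rwa [integral_const_mul] at this
  have hfa := h.abs_integral_flattened_le hA hγ hγ1 hα hc hB v
  have hd : A * ‖x - y‖ ^ (γ - α)
      ≤ ‖x - y‖ ^ (β - α) * dissipation A γ β f x y / dissipationConst γ β := by
    rw [le_div_iff₀ hdc]
    calc _ = ‖x - y‖ ^ (β - α) * (dissipationConst γ β * (A * ‖x - y‖ ^ (γ - β))) := by
          rw [show γ - α = (β - α) + (γ - β) by ring, Real.rpow_add hξ]; ring
      _ ≤ _ := by gcongr; exact h.le_dissipation hβ hβ2 hf hB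
  have hfc := farConst_nonneg hα
  rw [hsplit]
  calc _ ≤ ‖v‖ * ‖x - y‖ ^ (β - α) * dissipation A γ β f x y
        + ‖v‖ * farConst α * (A * ‖x - y‖ ^ (γ - α)) :=
        (abs_add_le _ _).trans (add_le_add hn hfa)
    _ ≤ ‖v‖ * ‖x - y‖ ^ (β - α) * dissipation A γ β f x y
        + ‖v‖ * farConst α *
          (‖x - y‖ ^ (β - α) * dissipation A γ β f x y / dissipationConst γ β) := by gcongr
    _ = _ := by ring

/-- The velocity increment along the line through a touching pair. -/
theorem abs_inner_velocity_sub_le (h : IsTouching A γ f x y) (hA : 0 ≤ A) (hγ : 0 < γ)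
    (hγ1 : γ < 1) (hα : 0 < α) (hα1 : α < 1) (hαβ : α < β) (hβ2 : β < 2)
    (hf : ContDiff ℝ 2 f) (hB : ∀ x, |f x| ≤ B) (hM : ∀ a b, |f a - f b| ≤ M * ‖a - b‖) :
    |inner ℝ (x - y) (velocity α f x - velocity α f y)|
      ≤ velocityConst α * (2 * (1 + farConst α / dissipationConst γ β)) *
        ‖x - y‖ ^ (β - α + 1) * dissipation A γ β f x y := by
  have hξ := h.norm_pos
  have h0 := h.abs_oddIntegral_sub_le hA hγ hγ1 hα hα1 hαβ hβ2 hf hB hM (EuclideanSpace.single 0 1)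
  have h1 := h.abs_oddIntegral_sub_le hA hγ hγ1 hα hα1 hαβ hβ2 hf hB hM (EuclideanSpace.single 1 1)
  have hv := velocityConst_pos hα hα1
  simp only [PiLp.norm_single, norm_one, one_mul] at h0 h1
  set Q := (1 + farConst α / dissipationConst γ β) * ‖x - y‖ ^ (β - α) *
    dissipation A γ β f x y with hQ
  have hc : ∀ j : Fin 2, |(x - y) j| ≤ ‖x - y‖ := fun j => by
    simpa using PiLp.norm_apply_le (x - y) j
  have e : inner ℝ (x - y) (velocity α f x - velocity α f y)
      = velocityConst α * ((x - y) 0 * (oddIntegral α (EuclideanSpace.single 1 1) f x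
          - oddIntegral α (EuclideanSpace.single 1 1) f y)
        - (x - y) 1 * (oddIntegral α (EuclideanSpace.single 0 1) f x
          - oddIntegral α (EuclideanSpace.single 0 1) f y)) := by
    rw [PiLp.inner_apply, Fin.sum_univ_two]
    simp [velocity]
    ring
  rw [e, abs_mul, abs_of_pos hv]
  calc _ ≤ velocityConst α * (‖x - y‖ * Q + ‖x - y‖ * Q) := by
        gcongr
        refine (abs_sub _ _).trans (add_le_add ?_ ?_)
        · rw [abs_mul]
          gcongr
          exact hc 0
        · rw [abs_mul]
          gcongr
          exact hc 1
    _ = _ := by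
        rw [hQ, Real.rpow_add_one hξ.ne']
        ring

end IsTouching

/-! ### Maximum principles -/

theorem deriv_nonneg_of_le_left {q : ℝ → ℝ} {t q' : ℝ} (ht : 0 < t) (h : HasDerivAt q q' t)
    (hq : ∀ s, 0 ≤ s → s < t → q s ≤ q t) : 0 ≤ q' := by
  have hl := (hasDerivWithinAt_iff_tendsto_slope' (s := Iio t) (by simp)).1 h.hasDerivWithinAt
  refine ge_of_tendsto hl ?_
  filter_upwards [Ioo_mem_nhdsLT ht] with s hs
  rw [slope_def_field]
  exact div_nonneg_of_nonpos (by linarith [hq s hs.1.le hs.2]) (by linarith [hs.2])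

theorem iteratedFDeriv_two_nonpos_of_max {f : Plane → ℝ} (hf : ContDiff ℝ 2 f) {x : Plane}
    (hmax : ∀ z, f z ≤ f x) (e : Plane) : iteratedFDeriv ℝ 2 f x ![e, e] ≤ 0 := by
  have hf1 : ContDiff ℝ 1 (fderiv ℝ f) := hf.fderiv_right (by norm_num)
  have hline : ∀ s : ℝ, HasDerivAt (fun s : ℝ => x + s • e) e s := fun s => by
    simpa using ((hasDerivAt_id s).smul_const e).const_add x
  have hd1 : ∀ s : ℝ, HasDerivAt (fun s : ℝ => f (x + s • e)) (fderiv ℝ f (x + s • e) e) s :=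
    fun s => ((hf.differentiable (by norm_num) _).hasFDerivAt).comp_hasDerivAt s (hline s)
  have hd : deriv (fun s : ℝ => f (x + s • e)) = fun s => fderiv ℝ f (x + s • e) e :=
    funext fun s => (hd1 s).deriv
  have hd2 : HasDerivAt (fun s : ℝ => fderiv ℝ f (x + s • e) e)
      (fderiv ℝ (fderiv ℝ f) x e e) 0 := by
    have h0 : HasFDerivAt (fderiv ℝ f) (fderiv ℝ (fderiv ℝ f) x) (x + (0 : ℝ) • e) := by
      rw [zero_smul, add_zero]
      exact (hf1.differentiable (by norm_num) x).hasFDerivAt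
    have h1 : HasDerivAt (fun s : ℝ => fderiv ℝ f (x + s • e)) (fderiv ℝ (fderiv ℝ f) x e) 0 :=
      h0.comp_hasDerivAt (0 : ℝ) (hline 0)
    exact (ContinuousLinearMap.apply ℝ ℝ e).hasFDerivAt.comp_hasDerivAt (0 : ℝ) h1
  rw [iteratedFDeriv_two_apply]
  simp only [Matrix.cons_val_zero, Matrix.cons_val_one]
  by_contra! hpos
  have hmaxl : IsLocalMax (fun s : ℝ => f (x + s • e)) 0 :=
    Eventually.of_forall fun s => by simpa using hmax (x + s • e)
  have hmin := isLocalMin_of_deriv_deriv_pos (f := fun s : ℝ => f (x + s • e)) (x₀ := 0)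
    (by rw [hd, hd2.deriv]; exact hpos) hmaxl.deriv_eq_zero (hd1 0).continuousAt
  have hconst : (fun s : ℝ => f (x + s • e)) =ᶠ[𝓝 0] fun _ => f (x + (0 : ℝ) • e) := by
    filter_upwards [hmaxl, hmin] with s h1 h2 using le_antisymm h1 h2
  have h3 := hconst.deriv.deriv_eq
  rw [hd, hd2.deriv] at h3
  simp at h3
  exact hpos.ne' h3

theorem laplacian_nonpos_of_max {f : Plane → ℝ} (hf : ContDiff ℝ 2 f) {x : Plane}
    (hmax : ∀ z, f z ≤ f x) : Δ f x ≤ 0 := by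
  rw [InnerProductSpace.laplacian_eq_iteratedFDeriv_orthonormalBasis f
    (EuclideanSpace.basisFun (Fin 2) ℝ)]
  exact Finset.sum_nonpos fun i _ => iteratedFDeriv_two_nonpos_of_max hf hmax _

theorem evenIntegral_nonneg_of_max {β : ℝ} {f : Plane → ℝ} {x : Plane} (hmax : ∀ z, f z ≤ f x) :
    0 ≤ evenIntegral β f x :=
  integral_nonneg fun z => mul_nonneg (by linarith [hmax (x + z), hmax (x - z)]) (by positivity)

/-- The maximum principle for the drift-diffusion equation
`∂ₜ θ + v · ∇θ + a (evenIntegral β θ) - ε Δθ = 0` with an arbitrary drift `v`. -/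
theorem le_of_drift_diffusion {θ : ℝ → Plane → ℝ} {β a ε A : ℝ} (ha : 0 ≤ a) (hε : 0 ≤ ε)
    (hcont : ContinuousOn (fun p : ℝ × Plane => θ p.1 p.2) (Ici 0 ×ˢ univ))
    (hdecay : ∀ T η : ℝ, 0 < η → ∃ R : ℝ, ∀ t ∈ Icc 0 T, ∀ x, R ≤ ‖x‖ → |θ t x| < η)
    (hdiff : ∀ t, 0 < t → ∀ x, DifferentiableAt ℝ (fun s => θ s x) t)
    (hC2 : ∀ t, 0 < t → ContDiff ℝ 2 (θ t))
    (heq : ∀ t, 0 < t → ∀ x, ∃ v, deriv (fun s => θ s x) t + fderiv ℝ (θ t) x v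
      + a * evenIntegral β (θ t) x - ε * Δ (θ t) x = 0)
    (hA : 0 ≤ A) (h0 : ∀ x, θ 0 x ≤ A) {t : ℝ} (ht : 0 ≤ t) (x : Plane) : θ t x ≤ A := by
  by_contra! hlt
  have ht0 : 0 < t := ht.lt_of_ne fun h => by rw [← h] at hlt; exact absurd (h0 x) hlt.not_ge
  set d := θ t x - A with hd
  have hd0 : 0 < d := sub_pos.2 hlt
  -- Subtracting `η s` makes the time derivative at a maximum strictly positive.
  set η := d / (2 * t) with hη
  have hη0 : 0 < η := by positivity
  have hηt : η * t = d / 2 := by rw [hη]; field_simp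
  obtain ⟨R, hR⟩ := hdecay t (A + d / 2) (by positivity)
  set K : Set (ℝ × Plane) := Icc 0 t ×ˢ Metric.closedBall 0 (max R ‖x‖)
  have hK : IsCompact K := isCompact_Icc.prod (isCompact_closedBall _ _)
  have hxK : (t, x) ∈ K := ⟨⟨ht, le_rfl⟩, by simp⟩
  have hgc : ContinuousOn (fun p : ℝ × Plane => θ p.1 p.2 - η * p.1) K :=
    (hcont.mono (prod_mono Icc_subset_Ici_self (subset_univ _))).sub (by fun_prop)
  obtain ⟨⟨τ, y⟩, hτK, hmax⟩ := hK.exists_isMaxOn ⟨_, hxK⟩ hgc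
  have hval : A + d / 2 ≤ θ τ y - η * τ := by
    have := hmax hxK
    simp only [mem_ofPred_eq] at this
    linarith
  have hτ : τ ∈ Icc 0 t := hτK.1
  have hglob : ∀ s ∈ Icc 0 t, ∀ z, θ s z - η * s ≤ θ τ y - η * τ := by
    intro s hs z
    by_cases hz : ‖z‖ ≤ max R ‖x‖
    · exact hmax (show (s, z) ∈ K from ⟨hs, by simpa using hz⟩)
    · have h1 := hR s hs z ((le_max_left _ _).trans (not_le.1 hz).le)
      have h2 := (abs_lt.1 h1).2
      have h3 : 0 ≤ η * s := mul_nonneg hη0.le hs.1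
      linarith
  have hτ0 : 0 < τ := by
    refine hτ.1.lt_of_ne fun h => ?_
    rw [← h, mul_zero] at hval
    linarith [h0 y]
  have hsp : ∀ z, θ τ z ≤ θ τ y := fun z => by linarith [hglob τ hτ z]
  have hder := deriv_nonneg_of_le_left (q := fun s => θ s y - η * s) hτ0
    ((hdiff τ hτ0 y).hasDerivAt.sub ((hasDerivAt_id τ).const_mul η))
    fun s hs hsτ => hglob s ⟨hs, hsτ.le.trans hτ.2⟩ y
  obtain ⟨v, hv⟩ := heq τ hτ0 y
  have hgrad : fderiv ℝ (θ τ) y = 0 :=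
    IsLocalMax.fderiv_eq_zero (Eventually.of_forall hsp)
  rw [hgrad] at hv
  have h1 := mul_nonneg ha (evenIntegral_nonneg_of_max (β := β) hsp)
  have h2 := mul_nonneg hε (neg_nonneg.2 (laplacian_nonpos_of_max (hC2 τ hτ0) hsp))
  simp only [zero_apply, mul_one] at hv hder
  linarith

theorem abs_le_of_drift_diffusion {θ : ℝ → Plane → ℝ} {β a ε A : ℝ} (ha : 0 ≤ a) (hε : 0 ≤ ε)
    (hcont : ContinuousOn (fun p : ℝ × Plane => θ p.1 p.2) (Ici 0 ×ˢ univ))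
    (hdecay : ∀ T η : ℝ, 0 < η → ∃ R : ℝ, ∀ t ∈ Icc 0 T, ∀ x, R ≤ ‖x‖ → |θ t x| < η)
    (hdiff : ∀ t, 0 < t → ∀ x, DifferentiableAt ℝ (fun s => θ s x) t)
    (hC2 : ∀ t, 0 < t → ContDiff ℝ 2 (θ t))
    (heq : ∀ t, 0 < t → ∀ x, ∃ v, deriv (fun s => θ s x) t + fderiv ℝ (θ t) x v
      + a * evenIntegral β (θ t) x - ε * Δ (θ t) x = 0)
    (h0 : ∀ x, |θ 0 x| ≤ A) {t : ℝ} (ht : 0 ≤ t) (x : Plane) : |θ t x| ≤ A := by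
  have hA : 0 ≤ A := (abs_nonneg _).trans (h0 0)
  refine abs_le'.2 ⟨le_of_drift_diffusion ha hε hcont hdecay hdiff hC2 heq hA
    (fun x => (le_abs_self _).trans (h0 x)) ht x, ?_⟩
  refine le_of_drift_diffusion (θ := fun t x => -θ t x) (β := β) ha hε hcont.neg
    (fun T η hη => ?_) (fun t ht x => (hdiff t ht x).neg) (fun t ht => (hC2 t ht).neg)
    (fun t ht x => ?_) hA (fun x => (neg_le_abs _).trans (h0 x)) ht x
  · simpa only [abs_neg] using hdecay T η hη
  · obtain ⟨v, hv⟩ := heq t ht x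
    refine ⟨v, ?_⟩
    have e1 : deriv (fun s => -θ s x) t = -deriv (fun s => θ s x) t := deriv.fun_neg
    have e2 : fderiv ℝ (fun x => -θ t x) x = -fderiv ℝ (θ t) x := fderiv_fun_neg
    have e3 : evenIntegral β (fun x => -θ t x) x = -evenIntegral β (θ t) x := by
      rw [evenIntegral, evenIntegral, ← integral_neg]
      exact integral_congr_ae (Eventually.of_forall fun z => by simp only; ring)
    have e4 : Δ (fun x => -θ t x) x = -Δ (θ t) x :=
      congrFun (InnerProductSpace.laplacian_neg (f := θ t)) x
    rw [e1, e2, e3, e4, neg_apply]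
    linarith

/-- A modulus `A ξ ^ γ` that is violated at some time is touched at an earlier, first time. The
Lipschitz bound keeps the violating pairs away from the diagonal, the decay and the sup bound keep
them in a compact set. -/
theorem sub_lt_of_forall_not_touching {θ : ℝ → Plane → ℝ} {A γ N : ℝ} (hA : 0 < A) (hγ : 0 < γ)
    (hγ1 : γ < 1)
    (hcont : ContinuousOn (fun p : ℝ × Plane => θ p.1 p.2) (Ici 0 ×ˢ univ))
    (hdecay : ∀ T η : ℝ, 0 < η → ∃ R : ℝ, ∀ t ∈ Icc 0 T, ∀ x, R ≤ ‖x‖ → |θ t x| < η)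
    (hlip : ∀ T : ℝ, ∃ M : ℝ, 0 ≤ M ∧ ∀ t ∈ Icc 0 T, ∀ x y, |θ t x - θ t y| ≤ M * ‖x - y‖)
    (hN : ∀ t, 0 ≤ t → ∀ x, |θ t x| ≤ N)
    (h0 : ∀ x y, x ≠ y → θ 0 x - θ 0 y < A * ‖x - y‖ ^ γ)
    (hstep : ∀ t, 0 < t → ∀ x y, IsTouching A γ (θ t) x y →
      ¬ ∀ s, 0 ≤ s → s < t → θ s x - θ s y ≤ θ t x - θ t y)
    {t : ℝ} (ht : 0 ≤ t) {x y : Plane} (hxy : x ≠ y) : θ t x - θ t y < A * ‖x - y‖ ^ γ := by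
  by_contra! hviol
  obtain ⟨M, hM0, hM⟩ := hlip t
  set ξ₀ : ℝ := (A / (M + 1)) ^ (1 / (1 - γ)) with hξ₀
  have hξ₀0 : 0 < ξ₀ := by positivity
  have hdiag : ∀ s ∈ Icc 0 t, ∀ a b, a ≠ b → A * ‖a - b‖ ^ γ ≤ θ s a - θ s b → ξ₀ ≤ ‖a - b‖ := by
    intro s hs a b hab h
    have hr : 0 < ‖a - b‖ := norm_sub_pos_iff.2 hab
    have h1 : A * ‖a - b‖ ^ γ ≤ (M + 1) * ‖a - b‖ := by
      have := (le_abs_self _).trans (hM s hs a b)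
      linarith
    have h2 : A / (M + 1) ≤ ‖a - b‖ ^ (1 - γ) := by
      rw [div_le_iff₀ (by positivity), Real.rpow_sub hr, Real.rpow_one, div_mul_eq_mul_div,
        le_div_iff₀ (by positivity)]
      linarith
    calc ξ₀ ≤ (‖a - b‖ ^ (1 - γ)) ^ (1 / (1 - γ)) := by
          rw [hξ₀]
          exact Real.rpow_le_rpow (by positivity) h2 (by
            have : 0 < 1 - γ := by linarith
            positivity)
      _ = ‖a - b‖ := by
          rw [← Real.rpow_mul hr.le, mul_one_div_cancel (by linarith), Real.rpow_one]
  set ξ₁ : ℝ := (2 * N / A) ^ (1 / γ) with hξ₁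
  have hfar : ∀ s ∈ Icc 0 t, ∀ a b, A * ‖a - b‖ ^ γ ≤ θ s a - θ s b → ‖a - b‖ ≤ ξ₁ := by
    intro s hs a b h
    have h1 : ‖a - b‖ ^ γ ≤ 2 * N / A := by
      rw [le_div_iff₀ hA]
      have ha := (abs_le.1 (hN s hs.1 a)).2
      have hb := (abs_le.1 (hN s hs.1 b)).1
      linarith
    calc ‖a - b‖ = (‖a - b‖ ^ γ) ^ (1 / γ) := by
          rw [← Real.rpow_mul (norm_nonneg _), mul_one_div_cancel hγ.ne', Real.rpow_one]
      _ ≤ ξ₁ := Real.rpow_le_rpow (by positivity) h1 (by positivity)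
  obtain ⟨R, hR⟩ := hdecay t (A * ξ₀ ^ γ / 2) (by positivity)
  have hball : ∀ s ∈ Icc 0 t, ∀ a b, a ≠ b → A * ‖a - b‖ ^ γ ≤ θ s a - θ s b →
      ‖a‖ ≤ R + ξ₁ ∧ ‖b‖ ≤ R + ξ₁ := by
    intro s hs a b hab h
    have h1 := hfar s hs a b h
    have h2 : A * ξ₀ ^ γ ≤ A * ‖a - b‖ ^ γ := by
      gcongr
      exact hdiag s hs a b hab h
    have h3 : ‖a‖ ≤ ‖b‖ + ‖a - b‖ := by
      have := norm_add_le b (a - b)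
      rwa [add_sub_cancel] at this
    have h4 : ‖b‖ ≤ ‖a‖ + ‖a - b‖ := by
      have := norm_sub_le a (a - b)
      rwa [sub_sub_cancel] at this
    by_cases ha : R ≤ ‖a‖
    · by_cases hb : R ≤ ‖b‖
      · have h5 := (abs_lt.1 (hR s hs a ha)).2
        have h6 := (abs_lt.1 (hR s hs b hb)).1
        linarith
      · constructor <;> linarith [norm_nonneg (a - b)]
    · constructor <;> linarith [norm_nonneg (a - b)]
  set P : Set (ℝ × Plane × Plane) :=
    Icc 0 t ×ˢ (Metric.closedBall 0 (R + ξ₁) ×ˢ Metric.closedBall 0 (R + ξ₁)) with hP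
  have hPc : IsCompact P :=
    isCompact_Icc.prod ((isCompact_closedBall _ _).prod (isCompact_closedBall _ _))
  have hG1 : ContinuousOn (fun p : ℝ × Plane × Plane => θ p.1 p.2.1) P :=
    hcont.comp (f := fun p : ℝ × Plane × Plane => (p.1, p.2.1)) (by fun_prop)
      fun p hp => ⟨hp.1.1, mem_univ _⟩
  have hG2 : ContinuousOn (fun p : ℝ × Plane × Plane => θ p.1 p.2.2) P :=
    hcont.comp (f := fun p : ℝ × Plane × Plane => (p.1, p.2.2)) (by fun_prop)
      fun p hp => ⟨hp.1.1, mem_univ _⟩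
  have hG3 : Continuous fun p : ℝ × Plane × Plane => A * ‖p.2.1 - p.2.2‖ ^ γ :=
    continuous_const.mul (Continuous.rpow_const (by fun_prop) fun _ => Or.inr hγ.le)
  have hG4 : Continuous fun p : ℝ × Plane × Plane => ‖p.2.1 - p.2.2‖ - ξ₀ := by fun_prop
  have hG : ContinuousOn (fun p : ℝ × Plane × Plane => min (‖p.2.1 - p.2.2‖ - ξ₀)
      (θ p.1 p.2.1 - θ p.1 p.2.2 - A * ‖p.2.1 - p.2.2‖ ^ γ)) P :=
    hG4.continuousOn.inf ((hG1.sub hG2).sub hG3.continuousOn)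
  -- The violating pairs; `ξ₀ ≤ |a - b|` replaces `a ≠ b`, which is not a closed condition.
  set K : Set (ℝ × Plane × Plane) := P ∩ (fun p : ℝ × Plane × Plane =>
    min (‖p.2.1 - p.2.2‖ - ξ₀) (θ p.1 p.2.1 - θ p.1 p.2.2 - A * ‖p.2.1 - p.2.2‖ ^ γ)) ⁻¹' Ici 0
    with hK
  have hKc : IsCompact K := hPc.of_isClosed_subset
    (hG.preimage_isClosed_of_isClosed hPc.isClosed isClosed_Ici) inter_subset_left
  have hmem : ∀ s ∈ Icc 0 t, ∀ a b, a ≠ b → A * ‖a - b‖ ^ γ ≤ θ s a - θ s b → (s, a, b) ∈ K := by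
    intro s hs a b hab h
    have hb := hball s hs a b hab h
    refine ⟨⟨hs, by simpa using hb.1, by simpa using hb.2⟩, ?_⟩
    exact show 0 ≤ min (‖a - b‖ - ξ₀) (θ s a - θ s b - A * ‖a - b‖ ^ γ) from
      le_min (sub_nonneg.2 (hdiag s hs a b hab h)) (sub_nonneg.2 h)
  obtain ⟨⟨τ, a, b⟩, hτK, hmin⟩ := hKc.exists_isMinOn
    ⟨_, hmem t ⟨ht, le_rfl⟩ x y hxy hviol⟩ continuous_fst.continuousOn
  have hτ : τ ∈ Icc 0 t := hτK.1.1
  have hτ2 : 0 ≤ min (‖a - b‖ - ξ₀) (θ τ a - θ τ b - A * ‖a - b‖ ^ γ) := hτK.2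
  have hab : a ≠ b := by
    rintro rfl
    have := hτ2.trans (min_le_left _ _)
    rw [sub_self, norm_zero] at this
    linarith
  have hge : A * ‖a - b‖ ^ γ ≤ θ τ a - θ τ b := sub_nonneg.1 (hτ2.trans (min_le_right _ _))
  have hτ0 : 0 < τ := by
    refine hτ.1.lt_of_ne fun h => ?_
    rw [← h] at hge
    exact absurd (h0 a b hab) hge.not_gt
  have hbefore : ∀ s, 0 ≤ s → s < τ → ∀ a' b', a' ≠ b' →
      θ s a' - θ s b' < A * ‖a' - b'‖ ^ γ := by
    intro s hs hsτ a' b' hne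
    by_contra! h
    exact absurd (hmin (hmem s ⟨hs, hsτ.le.trans hτ.2⟩ a' b' hne h)) (not_le.2 hsτ)
  have hct : ∀ z, Tendsto (fun s => θ s z) (𝓝[<] τ) (𝓝 (θ τ z)) := by
    intro z
    have : ContinuousOn (fun s => θ s z) (Ici 0) :=
      hcont.comp (f := fun s : ℝ => (s, z)) (by fun_prop) fun s hs => ⟨hs, mem_univ _⟩
    exact (this.continuousAt (Ici_mem_nhds hτ0)).tendsto.mono_left nhdsWithin_le_nhds
  have hle : ∀ a' b', θ τ a' - θ τ b' ≤ A * ‖a' - b'‖ ^ γ := by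
    intro a' b'
    rcases eq_or_ne a' b' with rfl | hne
    · rw [sub_self]; positivity
    · refine le_of_tendsto ((hct a').sub (hct b')) ?_
      filter_upwards [Ioo_mem_nhdsLT hτ0] with s hs
      exact (hbefore s hs.1.le hs.2 a' b' hne).le
  have heq : θ τ a - θ τ b = A * ‖a - b‖ ^ γ := le_antisymm (hle a b) hge
  refine hstep τ hτ0 a b ⟨hab, hle, heq⟩ fun s hs hsτ => ?_
  rw [heq]
  exact (hbefore s hs hsτ a b hab).le

namespace IsTouching

variable {A γ : ℝ} {f : Plane → ℝ} {x y : Plane}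

/-- The pair can be translated without gaining: `z ↦ f(x + z) - f(y + z)` is maximal at `0`. -/
theorem sub_le_sub (h : IsTouching A γ f x y) (z : Plane) :
    f (x + z) - f (y + z) ≤ f (x + 0) - f (y + 0) := by
  have := h.defect_nonneg z
  rw [defect, ← h.eq] at this
  simp only [add_zero]
  linarith

theorem laplacian_le (h : IsTouching A γ f x y) (hf : ContDiff ℝ 2 f) : Δ f x ≤ Δ f y := by
  have hs : ∀ c : Plane, ContDiff ℝ 2 fun z => f (c + z) := fun c =>
    hf.comp (contDiff_const.add contDiff_id)
  have h1 := laplacian_nonpos_of_max (f := (fun z => f (x + z)) - fun z => f (y + z))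
    ((hs x).sub (hs y)) (x := 0) h.sub_le_sub
  have hshift : ∀ c : Plane, Δ (fun z => f (c + z)) 0 = Δ f c := by
    intro c
    simp only [InnerProductSpace.laplacian_eq_iteratedFDeriv_orthonormalBasis _
      (EuclideanSpace.basisFun (Fin 2) ℝ), iteratedFDeriv_comp_add_left, add_zero]
  rw [ContDiffAt.laplacian_sub (hs x).contDiffAt (hs y).contDiffAt, hshift, hshift] at h1
  linarith

theorem fderiv_eq (h : IsTouching A γ f x y) (hf : ContDiff ℝ 2 f) :
    fderiv ℝ f x = fderiv ℝ f y := by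
  have hd := hf.differentiable (by norm_num)
  have h1 : IsLocalMax (fun z => f (x + z) - f (y + z)) 0 := Eventually.of_forall h.sub_le_sub
  have hs : ∀ c : Plane, HasFDerivAt (fun z => f (c + z)) (fderiv ℝ f c) 0 := by
    intro c
    have h2 : HasFDerivAt f (fderiv ℝ f c) (c + 0) := by
      rw [add_zero]; exact (hd c).hasFDerivAt
    exact h2.comp (0 : Plane) ((hasFDerivAt_id (0 : Plane)).const_add c)
  exact sub_eq_zero.1 (h1.hasFDerivAt_eq_zero ((hs x).sub (hs y)))

/-- The gradient at a touching pair points along the pair, with length `A γ |x - y| ^ (γ - 1)`. -/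
theorem fderiv_apply (h : IsTouching A γ f x y) (hf : ContDiff ℝ 2 f) (w : Plane) :
    fderiv ℝ f x w = A * γ * ‖x - y‖ ^ (γ - 2) * inner ℝ (x - y) w := by
  have hξ := h.norm_pos
  have hd := hf.differentiable (by norm_num)
  have h1 : HasFDerivAt (fun a : Plane => ‖a - y‖ ^ 2) (2 • innerSL ℝ (x - y)) x := by
    simpa using ((hasFDerivAt_id x).sub_const y).norm_sq
  have h2 := h1.rpow_const (p := γ / 2) (Or.inl (by positivity))
  have h3 : ∀ a : Plane, (‖a - y‖ ^ 2) ^ (γ / 2) = ‖a - y‖ ^ γ := fun a => by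
    rw [← Real.rpow_natCast, ← Real.rpow_mul (norm_nonneg _)]
    congr 1; push_cast; ring
  simp only [h3] at h2
  have hmax : IsLocalMax (fun a => f a - A * ‖a - y‖ ^ γ) x :=
    Eventually.of_forall fun a => by
      have := h.sub_le a y
      have := h.eq
      simp only
      linarith
  have h4 := hmax.hasFDerivAt_eq_zero ((hd x).hasFDerivAt.sub (h2.const_mul A))
  rw [sub_eq_zero.1 h4]
  have h5 : (‖x - y‖ ^ 2) ^ (γ / 2 - 1) = ‖x - y‖ ^ (γ - 2) := by
    rw [← Real.rpow_natCast, ← Real.rpow_mul (norm_nonneg _)]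
    congr 1; push_cast; ring
  simp only [smul_apply, innerSL_apply_apply, smul_eq_mul, h5, nsmul_eq_mul]
  push_cast
  ring

end IsTouching

/-! ### Preservation of the modulus -/

namespace IsGlobalSmoothSolution

variable {α β ν ε m : ℝ} {θ₀ : Plane → ℝ} {θ : ℝ → Plane → ℝ}

theorem contDiff (h : IsGlobalSmoothSolution α β ν ε m θ₀ θ) {t : ℝ} (ht : 0 < t) :
    ContDiff ℝ 2 (θ t) := by
  have h1 : ContDiffOn ℝ 2 (fun x => θ t x) univ :=
    (h.smooth.of_le (m := 2) (WithTop.coe_le_coe.2 (le_top : (2 : ℕ∞) ≤ ⊤))).comp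
      (f := fun x : Plane => (t, x))
      (contDiff_const.prodMk contDiff_id).contDiffOn fun x _ => ⟨ht, mem_univ x⟩
  exact contDiffOn_univ.1 h1

theorem isOpen_domain : IsOpen (Ioi (0 : ℝ) ×ˢ (univ : Set Plane)) := isOpen_Ioi.prod isOpen_univ

theorem hasDerivAt (h : IsGlobalSmoothSolution α β ν ε m θ₀ θ) {t : ℝ} (ht : 0 < t) (x : Plane) :
    HasDerivAt (fun s => θ s x)
      (fderiv ℝ (fun p : ℝ × Plane => θ p.1 p.2) (t, x) (1, 0)) t := by
  have h1 : DifferentiableAt ℝ (fun p : ℝ × Plane => θ p.1 p.2) (t, x) :=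
    (h.smooth.contDiffAt (isOpen_domain.mem_nhds
      (show (t, x) ∈ Ioi (0 : ℝ) ×ˢ univ from ⟨ht, mem_univ x⟩))).differentiableAt (by simp)
  exact h1.hasFDerivAt.comp_hasDerivAt (f := fun s : ℝ => (s, x)) t
    ((hasDerivAt_id t).prodMk (hasDerivAt_const t x))

theorem continuous_deriv (h : IsGlobalSmoothSolution α β ν ε m θ₀ θ) {t : ℝ} (ht : 0 < t) :
    Continuous fun x => deriv (fun s => θ s x) t := by
  simp_rw [fun x => (h.hasDerivAt ht x).deriv]
  have h1 := h.smooth.continuousOn_fderiv_of_isOpen isOpen_domain (by simp)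
  have h2 : ContinuousOn (fun x : Plane => fderiv ℝ (fun p : ℝ × Plane => θ p.1 p.2) (t, x)) univ :=
    h1.comp (f := fun x : Plane => (t, x)) (by fun_prop) fun x _ => ⟨ht, mem_univ x⟩
  exact (continuousOn_univ.1 h2).clm_apply continuous_const

/-- The equation holds at every point, with the singular integral representatives of the velocity
and of `Λ ^ β`: all its terms are continuous. -/
theorem equation_everywhere (h : IsGlobalSmoothSolution α β ν ε m θ₀ θ) (hα : 0 < α) (hα1 : α < 1)
    (hβ : 0 < β) (hβ2 : β < 2) {F : ℝ → Plane → ℂ} (hF : IsSpectralFamily θ F) {t : ℝ}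
    (ht : 0 < t) (x : Plane) :
    deriv (fun s => θ s x) t + fderiv ℝ (θ t) x (velocity α (θ t) x)
      + ν * (2 * lambdaConst β)⁻¹ * evenIntegral β (θ t) x - ε * Δ (θ t) x = 0 := by
  obtain ⟨u, g, hu, hg, heq⟩ := h.equation t ht
  have hC2 := h.contDiff ht
  have hrep := hF.eq_fourierInv t ht.le
  have hi := hF.integrable t ht.le
  have hi' := hF.integrable_norm_mul t ht.le
  have hB := hF.abs_le ht.le
  have hu' := hu.ae_eq_velocity hα hα1 (hF.ae_eq_fourier t ht.le) hrep hi hi'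
  have hg' := hg.ae_eq_evenIntegral hβ hβ2 hC2 hB (hF.ae_eq_fourier t ht.le) hrep hi
  have hlap : Continuous (Δ (θ t)) := by
    rw [InnerProductSpace.laplacian_eq_iteratedFDeriv_orthonormalBasis (θ t)
      (EuclideanSpace.basisFun (Fin 2) ℝ)]
    have hc : Continuous (iteratedFDeriv ℝ 2 (θ t)) := hC2.continuous_iteratedFDeriv (by simp)
    fun_prop
  have hcont : Continuous fun x => deriv (fun s => θ s x) t
      + fderiv ℝ (θ t) x (velocity α (θ t) x)
      + ν * (2 * lambdaConst β)⁻¹ * evenIntegral β (θ t) x - ε * Δ (θ t) x := by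
    have h1 := h.continuous_deriv ht
    have h2 := (hC2.continuous_fderiv (by norm_num)).clm_apply
      (continuous_velocity hα hα1 hrep hi hi')
    have h3 := continuous_evenIntegral hβ hβ2 hC2 hB
    exact ((h1.add h2).add (continuous_const.mul h3)).sub (continuous_const.mul hlap)
  have hae : (fun x => deriv (fun s => θ s x) t
      + fderiv ℝ (θ t) x (velocity α (θ t) x)
      + ν * (2 * lambdaConst β)⁻¹ * evenIntegral β (θ t) x - ε * Δ (θ t) x)
      =ᵐ[volume] fun _ => (0 : ℝ) := by
    filter_upwards [heq, hu', hg'] with x h1 h2 h3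
    rw [h2, h3, ← mul_assoc] at h1
    exact h1
  exact congrFun ((Continuous.ae_eq_iff_eq volume hcont continuous_const).1 hae) x

end IsGlobalSmoothSolution

theorem Obeys.continuous {f : Plane → ℝ} {H δ γ : ℝ} (hγ : 0 < γ) (hδ : 0 < δ)
    (h : Obeys f (stationaryModulus H δ γ)) : Continuous f := by
  refine continuous_iff_continuousAt.2 fun x => ?_
  rw [ContinuousAt, tendsto_iff_norm_sub_tendsto_zero]
  have hlim : Tendsto (fun y : Plane => H / δ ^ γ * ‖y - x‖ ^ γ) (𝓝 x) (𝓝 0) := by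
    have hc : Continuous fun y : Plane => H / δ ^ γ * ‖y - x‖ ^ γ :=
      continuous_const.mul (Continuous.rpow_const (by fun_prop) fun _ => Or.inr hγ.le)
    have := hc.tendsto x
    simpa [Real.zero_rpow hγ.ne'] using this
  refine squeeze_zero' (Eventually.of_forall fun y => norm_nonneg _) ?_ hlim
  filter_upwards [Metric.ball_mem_nhds x hδ] with y hy
  rcases eq_or_ne y x with rfl | hne
  · simp [Real.zero_rpow hγ.ne']
  · have h1 := h y x hne
    rw [stationaryModulus, if_pos (mem_ball_iff_norm.1 hy).le] at h1
    exact h1.le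

theorem abs_le_of_eLpNorm_top_le {f : Plane → ℝ} (hf : Continuous f) {c H : ℝ} (hc : 0 < c)
    (hH : 0 < H) (h : ENNReal.ofReal c * eLpNorm f ∞ volume ≤ ENNReal.ofReal H) (x : Plane) :
    |f x| ≤ H / c := by
  have h1 : eLpNormEssSup f volume ≤ ENNReal.ofReal (H / c) := by
    rw [eLpNorm_exponent_top] at h
    rw [ENNReal.ofReal_div_of_pos hc, ENNReal.le_div_iff_mul_le
      (Or.inl (by simpa using hc)) (Or.inl ENNReal.ofReal_ne_top), mul_comm]
    exact h
  by_contra! hx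
  have hopen : IsOpen {y | H / c < |f y|} := isOpen_lt continuous_const hf.abs
  refine (hopen.measure_pos volume ⟨x, hx⟩).ne' ?_
  refine measure_mono_null (fun y hy => ?_) (ae_iff.1 (ae_le_eLpNormEssSup (f := f) (μ := volume)))
  simp only [mem_ofPred_eq, not_le]
  refine h1.trans_lt ?_
  rw [← ofReal_norm]
  exact (ENNReal.ofReal_lt_ofReal_iff_of_nonneg (by positivity)).2 hy

/-- Obeying the stationary modulus means obeying both of its branches, the power branch for all
pairs because beyond `δ` it exceeds `H`. -/
theorem obeys_stationaryModulus_iff {f : Plane → ℝ} {H δ γ : ℝ} (hH : 0 < H) (hδ : 0 < δ)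
    (hγ : 0 < γ) :
    Obeys f (stationaryModulus H δ γ) ↔
      (∀ x y, x ≠ y → f x - f y < H / δ ^ γ * ‖x - y‖ ^ γ) ∧
        ∀ x y, δ < ‖x - y‖ → f x - f y < H := by
  have hmono : ∀ ξ, δ < ξ → H ≤ H / δ ^ γ * ξ ^ γ := by
    intro ξ hξ
    rw [div_mul_eq_mul_div, le_div_iff₀ (by positivity)]
    gcongr
  constructor
  · intro h
    refine ⟨fun x y hne => ?_, fun x y hxy => ?_⟩
    · have h1 := (le_abs_self _).trans_lt (h x y hne)
      rw [stationaryModulus] at h1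
      split_ifs at h1 with hle
      · exact h1
      · exact h1.trans_le (hmono _ (not_le.1 hle))
    · have hne : x ≠ y := by
        rintro rfl
        rw [sub_self, norm_zero] at hxy
        exact hxy.not_gt hδ
      have h1 := (le_abs_self _).trans_lt (h x y hne)
      rwa [stationaryModulus, if_neg (not_le.2 hxy)] at h1
  · rintro ⟨h1, h2⟩ x y hne
    rw [stationaryModulus]
    split_ifs with hle
    · refine abs_lt.2 ⟨?_, h1 x y hne⟩
      have := h1 y x hne.symm
      rw [norm_sub_rev] at this
      linarith
    · refine abs_lt.2 ⟨?_, h2 x y (not_le.1 hle)⟩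
      have := h2 y x (by rw [norm_sub_rev]; exact not_le.1 hle)
      linarith

/-- The factor by which the dissipation absorbs the velocity increment at a touching pair. -/
noncomputable def absorptionConst (α β γ : ℝ) : ℝ :=
  velocityConst α * (2 * (1 + farConst α / dissipationConst γ β))

theorem absorptionConst_pos {α β γ : ℝ} (hα : 0 < α) (hα1 : α < 1) (hγ1 : γ < 1) :
    0 < absorptionConst α β γ := by
  have h1 := velocityConst_pos hα hα1
  have h2 := farConst_nonneg hα
  have h3 := dissipationConst_pos (β := β) hγ1
  unfold absorptionConst
  positivity

/-- At a touching pair the slope `A γ ξ ^ (γ - 1)` of the modulus is so small at the scale `ξ` of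
the pair that the dissipation beats the advection; so the increment strictly decreases in time. -/
theorem IsGlobalSmoothSolution.not_touching {α β γ ν ε m A M : ℝ} {θ₀ : Plane → ℝ}
    {θ : ℝ → Plane → ℝ} (h : IsGlobalSmoothSolution α β ν ε m θ₀ θ) (hα : 0 < α) (hα1 : α < 1)
    (hαβ : α < β) (hβ2 : β < 2) (hγ : 0 < γ) (hγ1 : γ < 1) (hε : 0 < ε) (hA : 0 < A)
    {F : ℝ → Plane → ℂ} (hF : IsSpectralFamily θ F) {t : ℝ} (ht : 0 < t) {x y : Plane}
    (htouch : IsTouching A γ (θ t) x y) (hM : ∀ a b, |θ t a - θ t b| ≤ M * ‖a - b‖)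
    (hsmall : absorptionConst α β γ * (A * ‖x - y‖ ^ (γ - 1 + β - α))
      < ν * (2 * lambdaConst β)⁻¹) :
    ¬ ∀ s, 0 ≤ s → s < t → θ s x - θ s y ≤ θ t x - θ t y := by
  intro hleft
  have hβ := hα.trans hαβ
  have hξ := htouch.norm_pos
  have hC2 := h.contDiff ht
  have hB := hF.abs_le ht.le
  have hD := htouch.dissipation_pos hA hγ1 hβ hβ2 hC2 hB
  have hder := deriv_nonneg_of_le_left ht ((h.hasDerivAt ht x).sub (h.hasDerivAt ht y)) hleft
  rw [← (h.hasDerivAt ht x).deriv, ← (h.hasDerivAt ht y).deriv] at hder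
  have ex := h.equation_everywhere hα hα1 hβ hβ2 hF ht x
  have ey := h.equation_everywhere hα hα1 hβ hβ2 hF ht y
  rw [← htouch.fderiv_eq hC2, htouch.fderiv_apply hC2] at ey
  rw [htouch.fderiv_apply hC2] at ex
  have hlap := mul_le_mul_of_nonneg_left (htouch.laplacian_le hC2) hε.le
  have hdiss := htouch.evenIntegral_sub hβ hβ2 hC2 hB
  have hvel := htouch.abs_inner_velocity_sub_le hA.le hγ hγ1 hα hα1 hαβ hβ2 hC2 hB hM
  rw [inner_sub_right, ← absorptionConst] at hvel
  set P := A * γ * ‖x - y‖ ^ (γ - 2) with hP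
  set D := dissipation A γ β (θ t) x y with hDdef
  set a := ν * (2 * lambdaConst β)⁻¹ with ha
  set Ix := inner ℝ (x - y) (velocity α (θ t) x) with hIx
  set Iy := inner ℝ (x - y) (velocity α (θ t) y) with hIy
  have hP0 : 0 < P := by positivity
  have hadv : -(P * (Ix - Iy)) ≤ absorptionConst α β γ * (A * ‖x - y‖ ^ (γ - 1 + β - α)) * D := by
    have hK := absorptionConst_pos (β := β) hα hα1 hγ1
    calc -(P * (Ix - Iy)) ≤ P * |Ix - Iy| := by
          rw [← mul_neg]; gcongr; exact neg_le_abs _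
      _ ≤ P * (absorptionConst α β γ * ‖x - y‖ ^ (β - α + 1) * D) := by gcongr
      _ = γ * (absorptionConst α β γ * (A * (‖x - y‖ ^ (γ - 2) * ‖x - y‖ ^ (β - α + 1))) * D) := by
          rw [hP]; ring
      _ = γ * (absorptionConst α β γ * (A * ‖x - y‖ ^ (γ - 1 + β - α)) * D) := by
          rw [← Real.rpow_add hξ]
          congr 5; ring
      _ ≤ 1 * (absorptionConst α β γ * (A * ‖x - y‖ ^ (γ - 1 + β - α)) * D) := by gcongr
      _ = _ := one_mul _
  have hlt := mul_lt_mul_of_pos_right hsmall hD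
  have hdiss' : a * evenIntegral β (θ t) x - a * evenIntegral β (θ t) y = a * D := by
    rw [← mul_sub, hdiss]
  linarith

end GQG

theorem proposition5p3 (ν α β γ : ℝ) (hν : 0 < ν) (hα : 0 < α ∧ α < 1)
    (hβ : 2 * α < β ∧ β ≤ α + 1) (hγ : max (α + 1 - β) (α / 2) < γ ∧ γ < 1) :
    ∃ C₁ : ℝ, 0 < C₁ ∧
      ∀ (ε m : ℝ) (θ₀ : GQG.Plane → ℝ) (θ : ℝ → GQG.Plane → ℝ),
        0 < ε → 2 < m → GQG.IsGlobalSmoothSolution α β ν ε m θ₀ θ →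
        ∀ H δ c₁ : ℝ, 0 < H → 0 < δ → 0 < c₁ → c₁ ≤ 1 / 2 →
          ENNReal.ofReal (2 * (1 + c₁)) * eLpNorm θ₀ ∞ volume ≤ ENNReal.ofReal H →
          GQG.Obeys θ₀ (GQG.stationaryModulus H δ γ) →
          H ≤ C₁ * δ ^ (α + 1 - β) →
          ∀ t : ℝ, 0 < t → GQG.Obeys (θ t) (GQG.stationaryModulus H δ γ) := by
  obtain ⟨hα0, hα1⟩ := hα
  have hαβ : α < β := by linarith [hβ.1]
  have hβ0 : 0 < β := hα0.trans hαβ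
  have hβ2 : β < 2 := by linarith [hβ.2]
  have hγα : α + 1 - β < γ := (le_max_left _ _).trans_lt hγ.1
  have hγ0 : 0 < γ := by linarith [hβ.2]
  have hγ1 := hγ.2
  have hK := GQG.absorptionConst_pos (β := β) hα0 hα1 hγ1
  have hL := GQG.lambdaConst_pos hβ0 hβ2
  set a := ν * (2 * GQG.lambdaConst β)⁻¹ with ha
  have ha0 : 0 < a := by positivity
  refine ⟨a / (2 * GQG.absorptionConst α β γ), by positivity, ?_⟩
  intro ε m θ₀ θ hε hm hsol H δ c₁ hH hδ hc₁ _ hsup hobeys hHδ t ht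
  have hcont0 : ∀ t, 0 ≤ t → Continuous (θ t) := by
    intro t ht
    rcases ht.eq_or_lt with rfl | ht
    · rw [hsol.initial]
      exact hobeys.continuous hγ0 hδ
    · exact (hsol.contDiff ht).continuous
  obtain ⟨F, hF⟩ := hsol.sobolev.exists_isSpectralFamily hm hcont0
  have hinit : ∀ x, |θ 0 x| ≤ H / (2 * (1 + c₁)) := by
    rw [hsol.initial]
    exact GQG.abs_le_of_eLpNorm_top_le (hobeys.continuous hγ0 hδ) (by positivity) hH hsup
  have hbound : ∀ t, 0 ≤ t → ∀ x, |θ t x| ≤ H / (2 * (1 + c₁)) := fun t ht x =>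
    GQG.abs_le_of_drift_diffusion ha0.le hε.le hF.continuousOn
      (fun T η hη => hF.exists_uniform_decay T hη)
      (fun t ht x => (hsol.hasDerivAt ht x).differentiableAt) (fun t ht => hsol.contDiff ht)
      (fun t ht x => ⟨_, hsol.equation_everywhere hα0 hα1 hβ0 hβ2 hF ht x⟩) hinit ht x
  have hosc : ∀ t, 0 ≤ t → ∀ x y, θ t x - θ t y < H := by
    intro t ht x y
    have h1 := (abs_le.1 (hbound t ht x)).2
    have h2 := (abs_le.1 (hbound t ht y)).1
    have h3 : 2 * (H / (2 * (1 + c₁))) < H := by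
      rw [← mul_div_assoc, div_lt_iff₀ (by positivity)]
      nlinarith
    linarith
  have hobeys' := (GQG.obeys_stationaryModulus_iff hH hδ hγ0).1 hobeys
  refine (GQG.obeys_stationaryModulus_iff hH hδ hγ0).2 ⟨fun x y hne => ?_, fun x y _ =>
    hosc t ht.le x y⟩
  set A := H / δ ^ γ with hA
  have hA0 : 0 < A := by positivity
  refine GQG.sub_lt_of_forall_not_touching hA0 hγ0 hγ1 hF.continuousOn
    (fun T η hη => hF.exists_uniform_decay T hη) hF.exists_uniform_lipschitz hbound
    (by rw [hsol.initial]; exact hobeys'.1) (fun s hs x y htouch => ?_) ht.le hne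
  obtain ⟨M, -, hM⟩ := hF.exists_uniform_lipschitz s
  refine hsol.not_touching hα0 hα1 hαβ hβ2 hγ0 hγ1 hε hA0 hF hs htouch
    (hM s ⟨hs.le, le_rfl⟩) ?_
  have hξδ : ‖x - y‖ ≤ δ := by
    by_contra! hlt
    have h1 := hosc s hs.le x y
    rw [htouch.eq, hA, div_mul_eq_mul_div, div_lt_iff₀ (by positivity)] at h1
    exact absurd (Real.rpow_le_rpow hδ.le hlt.le hγ0.le)
      (not_le.2 (lt_of_mul_lt_mul_left h1 hH.le))
  have hslope : A * ‖x - y‖ ^ (γ - 1 + β - α) ≤ a / (2 * GQG.absorptionConst α β γ) := by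
    calc A * ‖x - y‖ ^ (γ - 1 + β - α) ≤ A * δ ^ (γ - 1 + β - α) := by
          gcongr
          linarith
      _ = H / δ ^ (α + 1 - β) := by
          rw [hA, div_mul_eq_mul_div, mul_div_assoc, ← Real.rpow_sub hδ, div_eq_mul_inv,
            ← Real.rpow_neg hδ.le]
          congr 2; ring
      _ ≤ _ := by rwa [div_le_iff₀ (by positivity)]
  calc GQG.absorptionConst α β γ * (A * ‖x - y‖ ^ (γ - 1 + β - α))
      ≤ GQG.absorptionConst α β γ * (a / (2 * GQG.absorptionConst α β γ)) := by gcongr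
    _ = a / 2 := by field_simp
    _ < a := by linarith
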